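/- Let $\mathbb{F}_q$ be a finite field, $n \ge 0$, and let $\mathbb{B}_n(q)$ be the lattice of all subspaces of $\mathbb{F}_q^n$. Let $\varphi : \mathbb{B}_n(q) \to \mathbb{N}$ be a $q$-matroid, i.e. $\varphi(x) \le \dim x$ for all $x$, $\varphi(x) \le \varphi(y)$ whenever $x \le y$, and $\varphi(x \vee y) + \varphi(x \wedge y) \le \varphi(x) + \varphi(y)$ for all $x, y$. Let $P(\varphi) = \{x \in \mathbb{B}_n(q) : \varphi(x) = \dim x\}$ be its poset of independent spaces, ordered by inclusion. Then $P(\varphi)$ is $\mathbb{B}(q)$-positive, and the chain polynomial of $P(\varphi)$ and the chain polynomials of all its rank-selected subposets $P(\varphi)_S = \{x \in P(\varphi) : \rho(x) \in S\}$, $S \subseteq \mathbb{N}$, are real-rooted. Here the notions are as follows. For a poset $P$, $\rho(x)$ is the maximal $k$ for which there is a chain $x_0 < x_1 < \dots < x_k = x$, and the rank of $P$ is $\sup_x \rho(x) \in \mathbb{N} \cup \{\infty\}$. $P$ is quasi-rank uniform if it is locally finite, has a least element, and the number of $z \le x$ with $\rho(z) = k$ depends only on $k$ and $m = \rho(x)$;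 this number is denoted $r_{m,k}$. Let $N$ be the rank of $P$, $R(P) = (r_{m,k})_{m,k=0}^N$ and $R_m(t) = \sum_{k=0}^m r_{m,k} t^k$. A quasi-rank uniform poset $P$ is a TN-poset if all minors of $R(P)$ are nonnegative. Then there are unique numbers $\lambda_{m,k} \ge 0$ ($0 \le k \le m < N$), such that $\lambda_{m,k} = 0$ implies $\lambda_{m+1,k} = 0$, and unique monic polynomials $R_{m,k}(t)$ ($0 \le k \le m \le N$), such that $R_{m,0} = R_m$, $R_{m,m} = t^m$, $t^k$ divides $R_{m,k}$, and $R_{m+1,k} = R_{m+1,k+1} + \lambda_{m,k} R_{m,k}$ for $0 \le k \le m < N$. A finite quasi-rank uniform poset $Q$ of rank $r$ is $P$-positive, for a TN-poset $P$, if $\sum_{x \le y} t^{\rho(x)} = R_{\rho(y)}(t)$ for all $y \in Q$, and $\sum_{x \in Q} t^{\rho(x)} = \sum_{k=0}^r h_k R_{r,k}(t)$ for some real numbers $h_0, \dots, h_r \ge 0$. $\mathbb{B}(q)$ is the poset of all finite-dimensional subspaces of $\mathbb{F}_q^{\mathbb{N}}$, ordered by inclusion (that it is a TN-poset is part of the claim).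 The chain polynomial of a finite poset $Q$ is $\sum_C t^{|C|}$, summed over all chains $C$ of $Q$, including the empty one. A real polynomial is real-rooted if all its complex zeros are real. -/

import Mathlib

open Polynomial

namespace TNPoset

/-! ### Quasi-rank uniform posets -/

section Posets

variable (P : Type*) [PartialOrder P]

/-- The quasi-rank `ρ(x)`: the maximal `k` such that there is a chain
`x₀ < x₁ < ⋯ < xₖ = x`. (`Order.height` is this supremum in `ℕ∞`; it is finite in the posets
below, which are locally finite with a least element.) -/
noncomputable def rho {P : Type*} [PartialOrder P] (x : P) : ℕ := (Order.height x).toNat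

/-- The quasi-rank of the poset `P`, the supremum of the quasi-ranks of its elements. -/
noncomputable def quasiRank : ℕ∞ := ⨆ x : P, (rho x : ℕ∞)

/-- The number of `z ≤ x` with `ρ(z) = k`. -/
noncomputable def lowerCount {P : Type*} [PartialOrder P] (x : P) (k : ℕ) : ℕ :=
  Nat.card {z : P // z ≤ x ∧ rho z = k}

/-- Quasi-rank uniform posets: locally finite, with a least element, and such that the number of
elements of quasi-rank `k` below `x` depends only on `k` and the quasi-rank of `x`. -/
structure IsQuasiRankUniform : Prop where
  locallyFinite : ∀ x y : P, (Set.Icc x y).Finite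
  exists_bot : ∃ b : P, ∀ x : P, b ≤ x
  uniform : ∀ x y : P, rho x = rho y → ∀ k ≤ rho x, lowerCount x k = lowerCount y k

open Classical in
/-- The matrix `R(P) = (r_{n,k})`: `r_{n,k}` is the number of elements of quasi-rank `k` below an
element `x` of quasi-rank `n`. Only the entries with indices at most `quasiRank P` matter;
the other ones are set to zero. -/
noncomputable def rankMatrix (n k : ℕ) : ℝ :=
  if h : ∃ x : P, rho x = n then (lowerCount h.choose k : ℝ) else 0

end Posets

/-! ### Totally nonnegative and resolvable matrices

Matrices are indexed by the natural numbers `0 ≤ n, k ≤ N`, where `N : ℕ∞`. -/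

/-- All minors of the matrix `(R n k)_{n,k=0}^N` are nonnegative. -/
def IsTotallyNonneg (N : ℕ∞) (R : ℕ → ℕ → ℝ) : Prop :=
  ∀ (m : ℕ) (a b : Fin m → ℕ), StrictMono a → StrictMono b →
    (∀ i, (a i : ℕ∞) ≤ N) → (∀ i, (b i : ℕ∞) ≤ N) →
    0 ≤ (Matrix.of fun i j => R (a i) (b j)).det

/-- The generating polynomial `R_n(t) = ∑_{k=0}^n r_{n,k} t^k` of the `n`th row. -/
noncomputable def rowPoly (R : ℕ → ℕ → ℝ) (n : ℕ) : ℝ[X] :=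
  ∑ k ∈ Finset.range (n + 1), C (R n k) * X ^ k

/-- The polynomials `S n k = R_{n,k}(t)`, `0 ≤ k ≤ n ≤ N`, resolve the matrix
`(R n k)_{n,k=0}^N` with the numbers `l n k = λ_{n,k}`, normalized by the condition that
`λ_{n,k} = 0` implies `λ_{n+1,k} = 0`, which makes `l` and `S` unique. -/
structure Resolves (N : ℕ∞) (R l : ℕ → ℕ → ℝ) (S : ℕ → ℕ → ℝ[X]) : Prop where
  nonneg : ∀ n k : ℕ, k ≤ n → (n : ℕ∞) < N → 0 ≤ l n k
  monic : ∀ n k : ℕ, k ≤ n → (n : ℕ∞) ≤ N → (S n k).Monic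
  row : ∀ n : ℕ, (n : ℕ∞) ≤ N → S n 0 = rowPoly R n
  diag : ∀ n : ℕ, (n : ℕ∞) ≤ N → S n n = X ^ n
  dvd : ∀ n k : ℕ, k ≤ n → (n : ℕ∞) ≤ N → X ^ k ∣ S n k
  step : ∀ n k : ℕ, k ≤ n → (n : ℕ∞) < N → S (n + 1) k = S (n + 1) (k + 1) + C (l n k) * S n k
  normalized : ∀ n k : ℕ, k ≤ n → ((n + 1 : ℕ) : ℕ∞) < N → l n k = 0 → l (n + 1) k = 0

/-! ### TN-posets and positivity relative to a TN-poset -/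

/-- A TN-poset is a quasi-rank uniform poset `P` such that `R(P)` is totally nonnegative. -/
structure IsTNPoset (P : Type*) [PartialOrder P] : Prop where
  quasiRankUniform : IsQuasiRankUniform P
  totallyNonneg : IsTotallyNonneg (quasiRank P) (rankMatrix P)

/-- `Q` is a combinatorial `P`-poset: `Q` is quasi-rank uniform, and for every `y` in `Q`, of
quasi-rank `m` say, `∑_{x ≤ y} t^{ρ(x)}` is the `m`th row polynomial of `R(P)`. -/
structure IsCombinatorialPoset (P Q : Type*) [PartialOrder P] [PartialOrder Q] : Prop where
  quasiRankUniform : IsQuasiRankUniform Q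
  rank_le : ∀ y : Q, (rho y : ℕ∞) ≤ quasiRank P
  sum_eq : ∀ y : Q, ∑ᶠ x : {x : Q // x ≤ y}, (X : ℝ[X]) ^ rho x.1 = rowPoly (rankMatrix P) (rho y)

/-- The rank generating polynomial `f_Q(t) = ∑_{x ∈ Q} t^{ρ(x)}` of a finite poset. -/
noncomputable def rankGenPoly (Q : Type*) [PartialOrder Q] [Finite Q] : ℝ[X] :=
  ∑ᶠ x : Q, (X : ℝ[X]) ^ rho x

/-- `P` is a TN-poset and `Q` is `P`-positive: `Q` is a combinatorial `P`-poset, of rank `r` say,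
and `f_Q(t) = ∑_{k=0}^r h_k R_{r,k}(t)` with `h_k ≥ 0`, where the `R_{n,k}(t)` are the polynomials
that resolve `R(P)`. -/
structure IsPositive (P Q : Type*) [PartialOrder P] [PartialOrder Q] [Finite Q] : Prop where
  isTNPoset : IsTNPoset P
  isCombinatorialPoset : IsCombinatorialPoset P Q
  expansion : ∃ (l : ℕ → ℕ → ℝ) (S : ℕ → ℕ → ℝ[X]) (r : ℕ) (h : ℕ → ℝ),
    Resolves (quasiRank P) (rankMatrix P) l S ∧ quasiRank Q = (r : ℕ∞) ∧
    (∀ k ≤ r, 0 ≤ h k) ∧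
    rankGenPoly Q = ∑ k ∈ Finset.range (r + 1), C (h k) * S r k

/-! ### Chain polynomials and rank selection -/

/-- The chain polynomial `c_Q(t) = ∑_C t^{|C|}`, summed over all chains `C` (including the empty
one) of a finite poset. -/
noncomputable def chainPoly (Q : Type*) [PartialOrder Q] [Finite Q] : ℝ[X] :=
  ∑ᶠ D : {D : Finset Q // IsChain (· ≤ ·) (D : Set Q)}, (X : ℝ[X]) ^ D.1.card

/-- The rank-selected subposet `Q_S = {x ∈ Q : ρ(x) ∈ S}`. -/
abbrev RankSelected (Q : Type*) [PartialOrder Q] (S : Set ℕ) : Type _ := {x : Q // rho x ∈ S}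

/-- All complex zeros are real. -/
def RealRooted (p : ℝ[X]) : Prop := ∀ z : ℂ, aeval z p = 0 → z.im = 0

/-! ### Subspace lattices and q-matroids -/

/-- `𝔹(q)`: the lattice of all finite dimensional subspaces of `𝔽_q^ℕ`, ordered by inclusion. -/
abbrev SubspacePoset (K : Type*) [Field K] : Type _ :=
  {U : Submodule K (ℕ → K) // FiniteDimensional K U}

/-- A q-matroid on the lattice `𝔹_n(q)` of all subspaces of `𝔽_q^n`. -/
structure IsQMatroid {K : Type*} [Field K] {n : ℕ} (φ : Submodule K (Fin n → K) → ℕ) : Prop where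
  le_dim : ∀ x, φ x ≤ Module.finrank K x
  mono : ∀ x y, x ≤ y → φ x ≤ φ y
  submodular : ∀ x y, φ (x ⊔ y) + φ (x ⊓ y) ≤ φ x + φ y

/-- `P(φ)`: the poset of independent spaces of `φ`, ordered by inclusion. -/
abbrev IndependentSpaces {K : Type*} [Field K] {n : ℕ} (φ : Submodule K (Fin n → K) → ℕ) :
    Type _ :=
  {x : Submodule K (Fin n → K) // φ x = Module.finrank K x}

end TNPoset

/-! Resolution. The Gaussian binomial matrix is resolved explicitly: `λ_{n,k} = q^k`, and
`R_{n+1,k+1}(t) = q^n t R_{n,k}(t/q)`. Both follow from the q-Pascal rule.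

Total nonnegativity (`det_qBinom_nonneg`). Taking differences of consecutive rows turns the matrix
into a block sum of `1` and a positive row and column rescaling of the matrix itself. Conversely its
rows are partial sums of these differences, so its minors are sums of minors of the difference
matrix, and induction on the row indices applies.

Positivity (`IsQMatroid.isNonnegCombination`). For `A` independent and `A ≤ B`, count the
independent spaces between `A` and `B`. If `B` is dependent, some hyperplane `H` of `B` contains a
basis of `B` above `A`. The spaces inside `H` are handled by induction. Those outside `H` are double
counted through the spaces `A'` covering `A` with `A'` not in `H`; this leads to intervals `[A', B]`
and the substitution taking `R_{r,k}` to `R_{r+1,k+1}`.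

Real-rootedness (`IsChainValue.interlaces`). Fix `z` in the upper half-plane. Let `ℓ` send `t^n` to
the value at `z` of the generating polynomial of chains whose top is a given element of rank `n`,
the empty chain being included in `ℓ(1)`; selecting ranks only replaces some of these polynomials by
zero. The chain polynomial at `z` is then `∑ h_k ℓ(R_{r,k})`. By induction on `n`, for `k ≤ l` the
argument of `ℓ(R_{n,l}) / ℓ(R_{n,k})` lies between `0` and that of `z/(1+z)`, which is less than
`π`. Since `h_0 = 1`, the sum cannot vanish; conjugation covers the lower half-plane. -/

namespace TNPoset

/-! ### Gaussian binomial coefficients and the coefficients of the resolving polynomials -/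

/-- Gaussian binomial coefficients, defined by a `q`-Pascal recursion. -/
def qBinom (q : ℕ) : ℕ → ℕ → ℕ
  | _, 0 => 1
  | 0, _ + 1 => 0
  | n + 1, k + 1 => q ^ (n - k) * qBinom q n k + qBinom q n (k + 1)

@[simp] theorem qBinom_zero_right (q n : ℕ) : qBinom q n 0 = 1 := by
  cases n <;> rfl

theorem qBinom_succ_succ (q n k : ℕ) :
    qBinom q (n + 1) (k + 1) = q ^ (n - k) * qBinom q n k + qBinom q n (k + 1) := rfl

theorem qBinom_eq_zero_of_lt (q : ℕ) : ∀ {n k : ℕ}, n < k → qBinom q n k = 0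
  | 0, k + 1, _ => rfl
  | n + 1, k + 1, h => by
    rw [qBinom_succ_succ, qBinom_eq_zero_of_lt q (by omega : n < k),
      qBinom_eq_zero_of_lt q (by omega : n < k + 1)]
    simp

@[simp] theorem qBinom_self (q n : ℕ) : qBinom q n n = 1 := by
  induction n with
  | zero => rfl
  | succ n ih => rw [qBinom_succ_succ, ih, qBinom_eq_zero_of_lt q (Nat.lt_succ_self n)]; simp

/-- `resCoeff q n k i` is the coefficient of `t ^ i` in the polynomial `R_{n,k}(t)` of the matrix
of Gaussian binomial coefficients. -/
def resCoeff (q : ℕ) : ℕ → ℕ → ℕ → ℕ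
  | n, 0, i => qBinom q n i
  | n + 1, k + 1, i + 1 => q ^ (n - i) * resCoeff q n k i
  | _, _ + 1, 0 => 0
  | 0, _ + 1, _ + 1 => 0

@[simp] theorem resCoeff_zero_mid (q n i : ℕ) : resCoeff q n 0 i = qBinom q n i := by
  cases n <;> cases i <;> rfl

theorem resCoeff_succ (q n k i : ℕ) :
    resCoeff q (n + 1) (k + 1) (i + 1) = q ^ (n - i) * resCoeff q n k i := rfl

@[simp] theorem resCoeff_succ_zero (q n k : ℕ) : resCoeff q n (k + 1) 0 = 0 := by
  cases n <;> rfl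

theorem resCoeff_eq_zero_of_lt_right (q : ℕ) : ∀ {n k i : ℕ}, n < i → resCoeff q n k i = 0
  | n, 0, i, h => by rw [resCoeff_zero_mid, qBinom_eq_zero_of_lt q h]
  | 0, k + 1, i + 1, _ => rfl
  | n + 1, k + 1, i + 1, h => by
    rw [resCoeff_succ, resCoeff_eq_zero_of_lt_right q (by omega : n < i), mul_zero]

theorem resCoeff_eq_zero_of_lt (q : ℕ) : ∀ {n k i : ℕ}, i < k → resCoeff q n k i = 0
  | n, k + 1, 0, _ => resCoeff_succ_zero q n k
  | 0, k + 1, i + 1, _ => rfl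
  | n + 1, k + 1, i + 1, h => by
    rw [resCoeff_succ, resCoeff_eq_zero_of_lt q (by omega : i < k), mul_zero]

theorem resCoeff_top (q : ℕ) : ∀ {n k : ℕ}, k ≤ n → resCoeff q n k n = 1
  | n, 0, _ => by simp
  | n + 1, k + 1, h => by
    rw [resCoeff_succ, resCoeff_top q (by omega : k ≤ n)]; simp

/-- The case `k = 0` is the q-Pascal rule. Under the shift, rows `n + 2` and `n + 1` are scaled by
`q^(n+1-i)` and `q^(n-i)`; the extra factor `q` raises `λ` from `q^k` to `q^(k+1)`. -/
theorem resCoeff_step (q : ℕ) : ∀ {n k : ℕ} (i : ℕ), k ≤ n →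
    resCoeff q (n + 1) k i = resCoeff q (n + 1) (k + 1) i + q ^ k * resCoeff q n k i
  | n, 0, 0, _ => by simp
  | n, 0, i + 1, _ => by simp [resCoeff_succ, qBinom_succ_succ]
  | n, k + 1, 0, _ => by simp
  | n + 1, k + 1, i + 1, h => by
    rw [resCoeff_succ, resCoeff_succ, resCoeff_succ, resCoeff_step q i (by omega : k ≤ n)]
    rcases le_or_gt i n with hi | hi
    · rw [show n + 1 - i = n - i + 1 by omega]; ring
    · rw [resCoeff_eq_zero_of_lt_right q hi]; ring

/-- The polynomials `R_{n,k}(t)` of the matrix of Gaussian binomial coefficients. -/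
noncomputable def resPoly (q n k : ℕ) : ℝ[X] :=
  ∑ i ∈ Finset.range (n + 1), C (resCoeff q n k i : ℝ) * X ^ i

theorem coeff_resPoly (q n k i : ℕ) : (resPoly q n k).coeff i = resCoeff q n k i := by
  simp only [resPoly, finsetSum_coeff, coeff_C_mul, coeff_X_pow, mul_ite, mul_one, mul_zero]
  rw [Finset.sum_ite_eq]
  split_ifs with h
  · rfl
  · rw [resCoeff_eq_zero_of_lt_right q (by simpa using h)]; simp

theorem resPoly_monic (q : ℕ) {n k : ℕ} (h : k ≤ n) : (resPoly q n k).Monic := by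
  refine monic_of_natDegree_le_of_coeff_eq_one n ?_ ?_
  · rw [natDegree_le_iff_coeff_eq_zero]
    intro i hi
    rw [coeff_resPoly, resCoeff_eq_zero_of_lt_right q hi, Nat.cast_zero]
  · rw [coeff_resPoly, resCoeff_top q h, Nat.cast_one]

/-- The polynomials `resPoly q n k` resolve the matrix of Gaussian binomial coefficients. -/
theorem resolves_qBinom {q : ℕ} (hq : 0 < q) (N : ℕ∞) (R : ℕ → ℕ → ℝ)
    (hR : ∀ n k, R n k = qBinom q n k) :
    Resolves N R (fun _ k => (q : ℝ) ^ k) (resPoly q) where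
  nonneg _ _ _ _ := by positivity
  monic _ _ h _ := resPoly_monic q h
  row n _ := by simp [resPoly, rowPoly, hR]
  diag n _ := by
    ext i
    rw [coeff_resPoly, coeff_X_pow]
    rcases lt_trichotomy i n with h | h | h
    · rw [resCoeff_eq_zero_of_lt q h, if_neg h.ne, Nat.cast_zero]
    · rw [h, resCoeff_top q le_rfl, if_pos rfl, Nat.cast_one]
    · rw [resCoeff_eq_zero_of_lt_right q h, if_neg h.ne', Nat.cast_zero]
  dvd n k _ _ := by
    rw [X_pow_dvd_iff]
    intro i hi
    rw [coeff_resPoly, resCoeff_eq_zero_of_lt q hi, Nat.cast_zero]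
  step n k h _ := by
    ext i
    rw [coeff_add, coeff_C_mul]
    simp only [coeff_resPoly]
    rw [resCoeff_step q i h]
    push_cast
    ring
  normalized n k _ _ h := absurd h (by positivity)

/-! ### Total nonnegativity of the matrix of Gaussian binomial coefficients -/

/-- The matrix of consecutive differences of the rows of `(qBinom q n k)`. -/
def qBinomDiff (q : ℕ) : ℕ → ℕ → ℕ
  | 0, 0 => 1
  | 0, _ + 1 => 0
  | _ + 1, 0 => 0
  | n + 1, k + 1 => q ^ (n - k) * qBinom q n k

theorem qBinom_succ_eq_add_diff (q n k : ℕ) :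
    qBinom q (n + 1) k = qBinomDiff q (n + 1) k + qBinom q n k := by
  cases k <;> simp [qBinomDiff, qBinom_succ_succ]

theorem qBinom_eq_sum_diff (q n k : ℕ) :
    qBinom q n k = ∑ j ∈ Finset.range (n + 1), qBinomDiff q j k := by
  induction n with
  | zero => cases k <;> simp [qBinomDiff, qBinom]
  | succ n ih => rw [Finset.sum_range_succ, ← ih, qBinom_succ_eq_add_diff, add_comm]

theorem qBinom_eq_sum_Ico_add (q k : ℕ) {m n : ℕ} (h : m ≤ n) :
    qBinom q n k = ∑ j ∈ Finset.Ico (m + 1) (n + 1), qBinomDiff q j k + qBinom q m k := by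
  rw [qBinom_eq_sum_diff q n, qBinom_eq_sum_diff q m, add_comm (∑ j ∈ Finset.Ico _ _, _),
    Finset.sum_range_add_sum_Ico _ (by omega)]

section Minors

variable {q : ℕ} {m : ℕ}

/-- Wherever the entry is nonzero, `q^(n-k)` is `q^n` times `q^(-k)`, so the two matrices differ by
a scaling of rows and columns. -/
theorem det_qBinomDiff_succ_succ (hq : 0 < q) (a b : Fin m → ℕ) :
    (Matrix.of fun i j => (qBinomDiff q (a i + 1) (b j + 1) : ℝ)).det =
      (∏ i, (q : ℝ) ^ a i) * (∏ j, ((q : ℝ) ^ b j)⁻¹) *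
        (Matrix.of fun i j => (qBinom q (a i) (b j) : ℝ)).det := by
  have hq' : (q : ℝ) ≠ 0 := by positivity
  have : (Matrix.of fun i j => (qBinomDiff q (a i + 1) (b j + 1) : ℝ)) =
      Matrix.of fun i j => (q : ℝ) ^ a i * (Matrix.of fun i j => ((q : ℝ) ^ b j)⁻¹ *
        (Matrix.of fun i j => (qBinom q (a i) (b j) : ℝ)) i j) i j := by
    ext i j
    simp only [Matrix.of_apply, qBinomDiff]
    rcases le_or_gt (b j) (a i) with h | h
    · push_cast
      rw [pow_sub₀ _ hq' h]
      ring
    · rw [qBinom_eq_zero_of_lt q h]; simp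
  rw [this, Matrix.det_mul_column, Matrix.det_mul_row]
  ring

/-- Row and column `0` of the difference matrix are zero apart from a `1` in the corner. A minor
therefore vanishes, or loses row and column `0`, or avoids both; what remains is a rescaled minor
with row indices lowered by one. -/
theorem det_qBinomDiff_nonneg (hq : 0 < q) (N : ℕ)
    (ih : ∀ (m : ℕ) (a b : Fin m → ℕ), StrictMono a → StrictMono b → (∀ i, a i < N) →
      0 ≤ (Matrix.of fun i j => (qBinom q (a i) (b j) : ℝ)).det)
    (a b : Fin m → ℕ) (ha : StrictMono a) (hb : StrictMono b) (haN : ∀ i, a i ≤ N) :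
    0 ≤ (Matrix.of fun i j => (qBinomDiff q (a i) (b j) : ℝ)).det := by
  have key : ∀ (m : ℕ) (a b : Fin m → ℕ), StrictMono a → StrictMono b → (∀ i, a i ≤ N) →
      (∀ i, 0 < a i) → (∀ i, 0 < b i) →
      0 ≤ (Matrix.of fun i j => (qBinomDiff q (a i) (b j) : ℝ)).det := by
    intro m a b ha hb haN ha0 hb0
    have h1 : a = fun i => (a i - 1) + 1 := by ext i; have := ha0 i; omega
    have h2 : b = fun i => (b i - 1) + 1 := by ext i; have := hb0 i; omega
    rw [h1, h2, det_qBinomDiff_succ_succ hq]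
    have := ih m (fun i => a i - 1) (fun i => b i - 1)
      (fun i j h => by have := ha h; have := ha0 i; simp only; omega)
      (fun i j h => by have := hb h; have := hb0 i; simp only; omega)
      (fun i => by have := haN i; have := ha0 i; omega)
    positivity
  cases m with
  | zero => simp
  | succ m =>
    have ha' : ∀ i : Fin m, a 0 < a i.succ := fun i => ha (Fin.succ_pos i)
    have hb' : ∀ i : Fin m, b 0 < b i.succ := fun i => hb (Fin.succ_pos i)
    rcases Nat.eq_zero_or_pos (a 0) with h0 | h0
    · have hrow : ∀ j : Fin m, qBinomDiff q (a 0) (b j.succ) = 0 := by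
        intro j
        obtain ⟨c, hc⟩ : ∃ c, b j.succ = c + 1 := ⟨b j.succ - 1, by have := hb' j; omega⟩
        rw [h0, hc]; rfl
      rw [Matrix.det_succ_row_zero, Fin.sum_univ_succ]
      simp only [Matrix.of_apply, hrow, Nat.cast_zero, mul_zero, zero_mul, Finset.sum_const_zero,
        add_zero, Fin.val_zero, pow_zero, one_mul]
      refine mul_nonneg (Nat.cast_nonneg _) ?_
      exact key m (fun i => a i.succ) (fun i => b i.succ)
        (fun i j h => ha (Fin.succ_lt_succ_iff.2 h)) (fun i j h => hb (Fin.succ_lt_succ_iff.2 h))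
        (fun i => haN _) (fun i => (Nat.zero_le _).trans_lt (ha' i))
        (fun i => (Nat.zero_le _).trans_lt (hb' i))
    · have hapos : ∀ i, 0 < a i := fun i => h0.trans_le (ha.monotone (Fin.zero_le i))
      rcases Nat.eq_zero_or_pos (b 0) with h1 | h1
      · rw [Matrix.det_eq_zero_of_column_eq_zero 0]
        intro i
        obtain ⟨c, hc⟩ : ∃ c, a i = c + 1 := ⟨a i - 1, by have := hapos i; omega⟩
        simp [hc, h1, qBinomDiff]
      · exact key _ a b ha hb haN hapos fun i => h1.trans_le (hb.monotone (Fin.zero_le i))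

/-- Subtracting from each selected row its predecessor leaves sums of difference rows over
consecutive disjoint intervals. Multilinearity then gives a sum of minors, whose row indices
increase because the intervals do. -/
theorem det_qBinom_nonneg_of_diff {N : ℕ} (a b : Fin m → ℕ) (ha : StrictMono a)
    (haN : ∀ i, a i ≤ N)
    (hdiff : ∀ c : Fin m → ℕ, StrictMono c → (∀ i, c i ≤ N) →
      0 ≤ (Matrix.of fun i j => (qBinomDiff q (c i) (b j) : ℝ)).det) :
    0 ≤ (Matrix.of fun i j => (qBinom q (a i) (b j) : ℝ)).det := by
  cases m with
  | zero => simp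
  | succ m =>
    let s : Fin (m + 1) → Finset ℕ :=
      Fin.cons (Finset.range (a 0 + 1)) fun i => Finset.Ico (a i.castSucc + 1) (a i.succ + 1)
    have hdet : (Matrix.of fun i j => (qBinom q (a i) (b j) : ℝ)).det =
        Matrix.detRowAlternating (R := ℝ) fun i => ∑ l ∈ s i, fun j => (qBinomDiff q l (b j) : ℝ) := by
      refine Matrix.det_eq_of_forall_row_eq_smul_add_pred (fun _ => 1) ?_ ?_
      · intro j
        simp [s, qBinom_eq_sum_diff q (a 0)]
      · intro i j
        simp [s, qBinom_eq_sum_Ico_add q (b j) (ha i.castSucc_lt_succ).le]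
    rw [hdet, ← AlternatingMap.coe_multilinearMap, MultilinearMap.map_sum_finset]
    refine Finset.sum_nonneg fun c hc => hdiff c ?_ ?_
    · rw [Fintype.mem_piFinset] at hc
      have hle : ∀ i, c i ≤ a i := by
        intro i
        have := hc i
        refine Fin.cases ?_ (fun i => ?_) i
        · have := hc 0
          simp only [s, Fin.cons_zero, Finset.mem_range] at this
          omega
        · have := hc i.succ
          simp only [s, Fin.cons_succ, Finset.mem_Ico] at this
          omega
      rw [Fin.strictMono_iff_lt_succ]
      intro i
      have h1 := hc i.succ
      simp only [s, Fin.cons_succ, Finset.mem_Ico] at h1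
      have := hle i.castSucc
      omega
    · rw [Fintype.mem_piFinset] at hc
      intro i
      refine Fin.cases ?_ (fun i => ?_) i
      · have := hc 0
        simp only [s, Fin.cons_zero, Finset.mem_range] at this
        have := haN 0
        omega
      · have := hc i.succ
        simp only [s, Fin.cons_succ, Finset.mem_Ico] at this
        have := haN i.succ
        omega

/-- The matrix of Gaussian binomial coefficients is totally nonnegative. -/
theorem det_qBinom_nonneg (hq : 0 < q) (N : ℕ) : ∀ (m : ℕ) (a b : Fin m → ℕ), StrictMono a →
    StrictMono b → (∀ i, a i < N) →
    0 ≤ (Matrix.of fun i j => (qBinom q (a i) (b j) : ℝ)).det := by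
  induction N with
  | zero =>
    intro m a b _ _ h
    cases m with
    | zero => simp
    | succ m => exact absurd (h 0) (Nat.not_lt_zero _)
  | succ N ih =>
    intro m a b ha hb h
    exact det_qBinom_nonneg_of_diff a b ha (fun i => Nat.le_of_lt_succ (h i))
      fun c hc hcN => det_qBinomDiff_nonneg hq N ih c b hc hb hcN

end Minors

theorem isTotallyNonneg_qBinom {q : ℕ} (hq : 0 < q) (N : ℕ∞) (R : ℕ → ℕ → ℝ)
    (hR : ∀ n k, R n k = qBinom q n k) : IsTotallyNonneg N R := by
  intro m a b ha hb _ _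
  simp only [hR]
  exact det_qBinom_nonneg hq (Finset.univ.sup a + 1) m a b ha hb
    fun i => Nat.lt_succ_of_le (Finset.le_sup (Finset.mem_univ i))

/-! ### Interlacing of values at a point of the upper half-plane -/

section Interlaces

open ComplexConjugate

/-- If `a ≠ 0`, then this says that `b / a` has its argument between `0` and that of `u`, where `u`
is in the upper half-plane. -/
def Interlaces (u a b : ℂ) : Prop := 0 ≤ (b * conj a).im ∧ 0 ≤ (u * a * conj b).im

namespace Interlaces

variable {u a b c : ℂ}

theorem zero_left : Interlaces u 0 b := by simp [Interlaces]

theorem zero_right : Interlaces u a 0 := by simp [Interlaces]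

theorem refl (hu : 0 < u.im) : Interlaces u a a := by
  constructor
  · rw [Complex.mul_conj]; simp
  · rw [mul_assoc, Complex.mul_conj, Complex.im_mul_ofReal]
    exact mul_nonneg hu.le (Complex.normSq_nonneg _)

theorem add_left (h : Interlaces u a c) (h' : Interlaces u b c) : Interlaces u (a + b) c := by
  refine ⟨?_, ?_⟩
  · rw [map_add, mul_add, Complex.add_im]; exact add_nonneg h.1 h'.1
  · rw [mul_add, add_mul, Complex.add_im]; exact add_nonneg h.2 h'.2

theorem add_right (h : Interlaces u a b) (h' : Interlaces u a c) : Interlaces u a (b + c) := by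
  refine ⟨?_, ?_⟩
  · rw [add_mul, Complex.add_im]; exact add_nonneg h.1 h'.1
  · rw [map_add, mul_add, Complex.add_im]; exact add_nonneg h.2 h'.2

theorem smul (h : Interlaces u a b) {x y : ℝ} (hx : 0 ≤ x) (hy : 0 ≤ y) :
    Interlaces u (x * a) (y * b) := by
  refine ⟨?_, ?_⟩
  · rw [show (y * b : ℂ) * conj (x * a) = ((y * x : ℝ) : ℂ) * (b * conj a) by
      simp only [map_mul, Complex.conj_ofReal]; push_cast; ring, Complex.im_ofReal_mul]
    exact mul_nonneg (mul_nonneg hy hx) h.1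
  · rw [show u * (x * a : ℂ) * conj (y * b) = ((x * y : ℝ) : ℂ) * (u * a * conj b) by
      simp only [map_mul, Complex.conj_ofReal]; push_cast; ring, Complex.im_ofReal_mul]
    exact mul_nonneg (mul_nonneg hx hy) h.2

theorem mul_left (h : Interlaces u a b) (c : ℂ) : Interlaces u (c * a) (c * b) := by
  refine ⟨?_, ?_⟩
  · rw [show c * b * conj (c * a) = (Complex.normSq c : ℂ) * (b * conj a) by
      rw [Complex.normSq_eq_conj_mul_self, map_mul]; ring, Complex.im_ofReal_mul]
    exact mul_nonneg (Complex.normSq_nonneg _) h.1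
  · rw [show u * (c * a) * conj (c * b) = (Complex.normSq c : ℂ) * (u * a * conj b) by
      rw [Complex.normSq_eq_conj_mul_self, map_mul]; ring, Complex.im_ofReal_mul]
    exact mul_nonneg (Complex.normSq_nonneg _) h.2

theorem sum_left {ι : Type*} {s : Finset ι} {f : ι → ℂ} (h : ∀ i ∈ s, Interlaces u (f i) b) :
    Interlaces u (∑ i ∈ s, f i) b :=
  Finset.sum_induction f (Interlaces u · b) (fun _ _ => add_left) zero_left h

theorem sum_right {ι : Type*} {s : Finset ι} {f : ι → ℂ} (h : ∀ i ∈ s, Interlaces u a (f i)) :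
    Interlaces u a (∑ i ∈ s, f i) :=
  Finset.sum_induction f (Interlaces u a ·) (fun _ _ => add_right) zero_right h

/-- The second inequality comes from the identity
`Im (u² w - |u|² w) = 2 Im u Re (u w)` for `w = a * conj c`, and `0 ≤ |u a + c|²`. -/
theorem mul_add_add (hu : 0 < u.im) (hab : Interlaces u a b) (hac : Interlaces u a c)
    (hbc : Interlaces u b c) : Interlaces u (u * a + b + c) (u * (a + b) + c) := by
  obtain ⟨h1, h2⟩ := hab
  obtain ⟨h3, h4⟩ := hac
  obtain ⟨h5, h6⟩ := hbc
  constructor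
  · have e : ((u * (a + b) + c) * conj (u * a + b + c)).im =
        (u * a * conj b).im + Complex.normSq u * (b * conj a).im + u.im * Complex.normSq b +
          (u * b * conj c).im + (c * conj b).im := by
      simp only [Complex.mul_im, Complex.mul_re, Complex.add_re, Complex.add_im, Complex.conj_re,
        Complex.conj_im, Complex.normSq_apply]
      ring
    rw [e]
    have := Complex.normSq_nonneg u
    have := Complex.normSq_nonneg b
    positivity
  · have e : (u * (u * a + b + c) * conj (u * (a + b) + c)).im =
        u.im * Complex.normSq (u * a + c) + Complex.normSq u * (u * a * conj b).im
        + Complex.normSq u * (b * conj a).im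
        + Complex.normSq u * (c * conj b).im + (u * b * conj c).im := by
      simp only [Complex.mul_im, Complex.mul_re, Complex.add_re, Complex.add_im, Complex.conj_re,
        Complex.conj_im, Complex.normSq_apply]
      ring
    rw [e]
    have := Complex.normSq_nonneg u
    have := Complex.normSq_nonneg (u * a + c)
    positivity

/-- If `b = -a`, the second inequality reads `0 ≤ -Im u |a|²`. -/
theorem add_ne_zero (hu : 0 < u.im) (h : Interlaces u a b) (ha : a ≠ 0) : a + b ≠ 0 := by
  intro e
  obtain rfl : b = -a := by linear_combination e
  have := h.2
  rw [map_neg, mul_neg, mul_assoc, Complex.mul_conj, Complex.neg_im, Complex.im_mul_ofReal] at this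
  have := mul_pos hu (Complex.normSq_pos.2 ha)
  linarith

end Interlaces

theorem sum_ne_zero_of_interlaces {u : ℂ} (hu : 0 < u.im) {r : ℕ} {g : ℕ → ℂ} {h : ℕ → ℝ}
    (hg : ∀ k ≤ r, Interlaces u (g 0) (g k)) (hg0 : g 0 ≠ 0) (hh : ∀ k ≤ r, 0 ≤ h k)
    (hh0 : 0 < h 0) : ∑ k ∈ Finset.range (r + 1), (h k : ℂ) * g k ≠ 0 := by
  rw [Finset.sum_range_succ', add_comm]
  refine Interlaces.add_ne_zero hu (Interlaces.sum_right fun k hk => ?_)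
    (mul_ne_zero (by exact_mod_cast hh0.ne') hg0)
  have hk' : k + 1 ≤ r := Nat.succ_le_of_lt (Finset.mem_range.1 hk)
  exact (hg _ hk').smul hh0.le (hh _ hk')

end Interlaces

/-! ### Interlacing of the values of the resolving polynomials -/

section ResolvedValues

variable {q : ℕ} {ℓ : ℕ → ℂ}

/-- The image of `R_{n,k}(t)` under the linear map that sends `t ^ i` to `ℓ i`. -/
noncomputable def resValue (q : ℕ) (ℓ : ℕ → ℂ) (n k : ℕ) : ℂ :=
  ∑ i ∈ Finset.range (n + 1), (resCoeff q n k i : ℂ) * ℓ i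

theorem resValue_self (q : ℕ) (ℓ : ℕ → ℂ) (n : ℕ) : resValue q ℓ n n = ℓ n := by
  rw [resValue, Finset.sum_eq_single n]
  · simp [resCoeff_top]
  · intro i hi hin
    rw [resCoeff_eq_zero_of_lt q (by simp at hi; omega)]; simp
  · simp

theorem resValue_step (q : ℕ) (ℓ : ℕ → ℂ) {n k : ℕ} (h : k ≤ n) :
    resValue q ℓ (n + 1) k = resValue q ℓ (n + 1) (k + 1) + q ^ k * resValue q ℓ n k := by
  have : resValue q ℓ n k = ∑ i ∈ Finset.range (n + 1 + 1), (resCoeff q n k i : ℂ) * ℓ i := by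
    rw [Finset.sum_range_succ, resCoeff_eq_zero_of_lt_right q (Nat.lt_succ_self n), resValue]
    simp
  rw [this, resValue, resValue, Finset.mul_sum, ← Finset.sum_add_distrib]
  refine Finset.sum_congr rfl fun i _ => ?_
  rw [resCoeff_step q i h]
  push_cast
  ring

/-- The sum of `λ_{n,j} R_{n,j}` over `k ≤ j ≤ n`. -/
noncomputable def resTail (q : ℕ) (ℓ : ℕ → ℂ) (n k : ℕ) : ℂ :=
  ∑ j ∈ Finset.Ico k (n + 1), (((q : ℝ) ^ j : ℝ) : ℂ) * resValue q ℓ n j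

/-- The recursion telescopes down from `R_{n+1,n+1} = t^(n+1)`. -/
theorem resValue_succ (q : ℕ) (ℓ : ℕ → ℂ) {n k : ℕ} (h : k ≤ n + 1) :
    resValue q ℓ (n + 1) k = ℓ (n + 1) + resTail q ℓ n k := by
  induction h using Nat.decreasingInduction with
  | self => simp [resValue_self, resTail]
  | of_succ k hk ih =>
    rw [resValue_step q ℓ (by omega), ih, resTail, resTail,
      Finset.sum_eq_sum_Ico_succ_bot hk]
    push_cast
    ring

theorem resTail_eq_add (q : ℕ) (ℓ : ℕ → ℂ) {n k l : ℕ} (hkl : k ≤ l) (hl : l ≤ n + 1) :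
    resTail q ℓ n k = ∑ j ∈ Finset.Ico k l, (((q : ℝ) ^ j : ℝ) : ℂ) * resValue q ℓ n j +
      resTail q ℓ n l :=
  (Finset.sum_Ico_consecutive _ hkl hl).symm

/-- `ℓ` assigns to `t ^ n` the value at `z` of the generating polynomial of chains with a fixed
greatest element of rank `n`, in a rank-selected subposet. -/
def IsChainValue (q : ℕ) (z : ℂ) (ℓ : ℕ → ℂ) : Prop :=
  ℓ 0 ≠ 0 ∧ ∀ n, ℓ (n + 1) = 0 ∨
    ℓ (n + 1) = z * ∑ i ∈ Finset.range (n + 1), (qBinom q (n + 1) i : ℂ) * ℓ i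

theorem one_add_ne_zero_of_im_pos {z : ℂ} (hz : 0 < z.im) : 1 + z ≠ 0 := fun h => by
  have := congrArg Complex.im h
  simp at this
  exact hz.ne' this

theorem div_one_add_im_pos {z : ℂ} (hz : 0 < z.im) : 0 < (z / (1 + z)).im := by
  have : (z / (1 + z)).im = z.im / Complex.normSq (1 + z) := by
    rw [Complex.div_im]
    simp
    ring
  rw [this]
  exact div_pos hz (Complex.normSq_pos.2 (one_add_ne_zero_of_im_pos hz))

/-- All pairs `k ≤ l` are carried through the induction because `Interlaces` is not transitive. -/
theorem IsChainValue.interlaces {z : ℂ} (hz : 0 < z.im) (hq : 0 < q) (h : IsChainValue q z ℓ)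
    (n : ℕ) : resValue q ℓ n 0 ≠ 0 ∧
      ∀ k l, k ≤ l → l ≤ n →
        Interlaces (z / (1 + z)) (resValue q ℓ n k) (resValue q ℓ n l) := by
  have hz1 := one_add_ne_zero_of_im_pos hz
  have hu := div_one_add_im_pos hz
  set u := z / (1 + z) with hu_def
  have hzu : z = (1 + z) * u := by rw [hu_def]; field_simp
  induction n with
  | zero =>
    have : resValue q ℓ 0 0 = ℓ 0 := resValue_self q ℓ 0
    refine ⟨this ▸ h.1, fun k l hkl hl => ?_⟩
    obtain rfl : l = 0 := by omega
    obtain rfl : k = 0 := by omega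
    exact Interlaces.refl hu
  | succ n ih =>
    obtain ⟨ih0, ih⟩ := ih
    have hpos : ∀ j, (0 : ℝ) ≤ (q : ℝ) ^ j := fun j => by positivity
    have hblock : ∀ s t : Finset ℕ, (∀ i ∈ s, ∀ j ∈ t, i ≤ j ∧ j ≤ n) →
        Interlaces u (∑ j ∈ s, (((q : ℝ) ^ j : ℝ) : ℂ) * resValue q ℓ n j)
          (∑ j ∈ t, (((q : ℝ) ^ j : ℝ) : ℂ) * resValue q ℓ n j) := fun s t hst =>
      Interlaces.sum_left fun i hi => Interlaces.sum_right fun j hj =>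
        (ih i j (hst i hi j hj).1 (hst i hi j hj).2).smul (hpos i) (hpos j)
    have hT0 : resTail q ℓ n 0 ≠ 0 := by
      rw [resTail, ← Finset.range_eq_Ico]
      exact sum_ne_zero_of_interlaces hu (fun k hk => ih 0 k (Nat.zero_le k) hk) ih0
        (fun k _ => hpos k) (by simp)
    rcases h.2 n with hl | hl
    -- Here `n + 1` is an omitted rank: the new values are plain tails, and the tail from `k` is the
    -- block `[k, l)` plus the tail from `l`.
    · have hval : ∀ k ≤ n + 1, resValue q ℓ (n + 1) k = resTail q ℓ n k := fun k hk => by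
        rw [resValue_succ q ℓ hk, hl, zero_add]
      refine ⟨hval 0 (Nat.zero_le _) ▸ hT0, fun k l hkl hln => ?_⟩
      rw [hval k (hkl.trans hln), hval l hln, resTail_eq_add q ℓ hkl hln]
      exact Interlaces.add_left (hblock _ _ fun i hi j hj => by
        simp at hi hj; omega) (Interlaces.refl hu)
    -- The sum in the recursion for `ℓ (n + 1)` is `ℓ (R_{n+1,0})` without its top term, which is
    -- the full tail.
    · have hl' : ℓ (n + 1) = z * resTail q ℓ n 0 := by
        have e := resValue_succ q ℓ (Nat.zero_le (n + 1))
        rw [resValue, Finset.sum_range_succ, resCoeff_top q (Nat.zero_le _), Nat.cast_one, one_mul,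
          add_comm] at e
        rw [hl, ← add_left_cancel e]
        simp
      refine ⟨?_, fun k l hkl hln => ?_⟩
      · rw [resValue_succ q ℓ (Nat.zero_le _), hl',
          show z * resTail q ℓ n 0 + resTail q ℓ n 0 = (1 + z) * resTail q ℓ n 0 by ring]
        exact mul_ne_zero hz1 hT0
      · rw [resValue_succ q ℓ (hkl.trans hln), resValue_succ q ℓ hln, hl',
          resTail_eq_add q ℓ (Nat.zero_le k) (hkl.trans hln), resTail_eq_add q ℓ hkl hln]
        have hAB := hblock (Finset.Ico 0 k) (Finset.Ico k l) fun i hi j hj => by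
          simp at hi hj; omega
        have hAC := hblock (Finset.Ico 0 k) (Finset.Ico l (n + 1)) fun i hi j hj => by
          simp at hi hj; omega
        have hBC := hblock (Finset.Ico k l) (Finset.Ico l (n + 1)) fun i hi j hj => by
          simp at hi hj; omega
        rw [resTail]
        generalize ∑ j ∈ Finset.Ico 0 k, (((q : ℝ) ^ j : ℝ) : ℂ) * resValue q ℓ n j = A at *
        generalize ∑ j ∈ Finset.Ico k l, (((q : ℝ) ^ j : ℝ) : ℂ) * resValue q ℓ n j = B at *
        generalize ∑ j ∈ Finset.Ico l (n + 1), (((q : ℝ) ^ j : ℝ) : ℂ) * resValue q ℓ n j = D at *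
        -- With `z = (1 + z) u`, the two values `z (A + B + D) + B + D` and `z (A + B + D) + D` are
        -- `1 + z` times `u A + B + D` and `u (A + B) + D`.
        have := (Interlaces.mul_add_add hu hAB hAC hBC).mul_left (1 + z)
        convert this using 1
        · linear_combination A * hzu
        · linear_combination (A + B) * hzu

theorem IsChainValue.sum_ne_zero {z : ℂ} (hz : 0 < z.im) (hq : 0 < q) (h : IsChainValue q z ℓ)
    {r : ℕ} {c : ℕ → ℝ} (hc : ∀ k ≤ r, 0 ≤ c k) (hc0 : 0 < c 0) :
    ∑ k ∈ Finset.range (r + 1), (c k : ℂ) * resValue q ℓ r k ≠ 0 := by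
  have hu := div_one_add_im_pos hz
  obtain ⟨h0, hI⟩ := h.interlaces hz hq r
  exact sum_ne_zero_of_interlaces hu (fun k hk => hI 0 k (Nat.zero_le k) hk) h0 hc hc0

end ResolvedValues

/-! ### Recursions for chain polynomials -/

section Chains

variable {Q : Type*} [PartialOrder Q] [Fintype Q]

open Classical in
/-- The generating polynomial of the chains in a given set. -/
noncomputable def chainPolyIn (U : Set Q) : ℝ[X] :=
  ∑ D ∈ Finset.univ.filter fun D : Finset Q =>
    IsChain (· ≤ ·) (D : Set Q) ∧ (D : Set Q) ⊆ U, X ^ D.card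

open Classical in
/-- The generating polynomial of the chains with greatest element `x`. -/
noncomputable def chainPolyTop (x : Q) : ℝ[X] :=
  ∑ D ∈ Finset.univ.filter fun D : Finset Q =>
    IsChain (· ≤ ·) (D : Set Q) ∧ x ∈ D ∧ ∀ y ∈ D, y ≤ x, X ^ D.card

theorem chainPoly_eq_chainPolyIn : chainPoly Q = chainPolyIn (Set.univ : Set Q) := by
  classical
  rw [chainPoly, finsum_eq_sum_of_fintype, chainPolyIn]
  simp only [Set.subset_univ, and_true]
  exact (Finset.sum_subtype _ (by simp) fun D : Finset Q => (X : ℝ[X]) ^ D.card).symm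

-- Nonempty chains are sorted by their greatest element; as `U` is a lower set, a chain lies in `U`
-- once its greatest element does.
open Classical in
theorem chainPolyIn_eq_add_sum {U : Set Q} (hU : IsLowerSet U) :
    chainPolyIn U = 1 + ∑ x : Q with x ∈ U, chainPolyTop x := by
  have hsplit : (Finset.univ.filter fun D : Finset Q =>
      IsChain (· ≤ ·) (D : Set Q) ∧ (D : Set Q) ⊆ U) =
      insert ∅ ((Finset.univ.filter fun x : Q => x ∈ U).biUnion fun x =>
        Finset.univ.filter fun D : Finset Q =>
          IsChain (· ≤ ·) (D : Set Q) ∧ x ∈ D ∧ ∀ y ∈ D, y ≤ x) := by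
    ext D
    simp only [Finset.mem_filter, Finset.mem_univ, true_and, Finset.mem_insert,
      Finset.mem_biUnion]
    constructor
    · rintro ⟨hD, hDU⟩
      rcases D.eq_empty_or_nonempty with h | h
      · exact Or.inl h
      · obtain ⟨x, hx⟩ := D.exists_maximal h
        refine Or.inr ⟨x, hDU hx.prop, hD, hx.prop, fun y hy => ?_⟩
        rcases hD.total hx.prop hy with h | h
        · exact hx.le_of_ge hy h
        · exact h
    · rintro (rfl | ⟨x, hx, hD, -, hle⟩)
      · simp
      · exact ⟨hD, fun y hy => hU (hle y hy) hx⟩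
  rw [chainPolyIn, hsplit, Finset.sum_insert, Finset.sum_biUnion]
  · simp [chainPolyTop]
  · intro x _ y _ hxy
    rw [Function.onFun, Finset.disjoint_left]
    intro D hD hD'
    simp only [Finset.mem_filter, Finset.mem_univ, true_and] at hD hD'
    exact hxy (le_antisymm (hD'.2.2 x hD.2.1) (hD.2.2 y hD'.2.1))
  · simp

theorem chainPolyTop_eq_mul (x : Q) : chainPolyTop x = X * chainPolyIn (Set.Iio x) := by
  classical
  rw [chainPolyTop, chainPolyIn, Finset.mul_sum]
  symm
  refine Finset.sum_bij' (fun D _ => insert x D) (fun D _ => D.erase x) ?_ ?_ ?_ ?_ ?_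
  · intro D hD
    simp only [Finset.mem_filter, Finset.mem_univ, true_and] at hD ⊢
    refine ⟨?_, Finset.mem_insert_self _ _, fun y hy => ?_⟩
    · rw [Finset.coe_insert]
      exact hD.1.insert fun y hy _ => Or.inr (hD.2 hy).le
    · rcases Finset.mem_insert.1 hy with rfl | hy
      · exact le_rfl
      · exact (hD.2 hy).le
  · intro D hD
    simp only [Finset.mem_filter, Finset.mem_univ, true_and] at hD ⊢
    refine ⟨hD.1.mono (by simp), fun y hy => ?_⟩
    have hy' := Finset.mem_erase.1 (Finset.mem_coe.1 hy)
    exact lt_of_le_of_ne (hD.2.2 y hy'.2) hy'.1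
  · intro D hD
    simp only [Finset.mem_filter, Finset.mem_univ, true_and] at hD
    exact Finset.erase_insert fun h => lt_irrefl x (hD.2 h)
  · intro D hD
    simp only [Finset.mem_filter, Finset.mem_univ, true_and] at hD
    exact Finset.insert_erase hD.2.1
  · intro D hD
    simp only [Finset.mem_filter, Finset.mem_univ, true_and] at hD
    rw [Finset.card_insert_of_notMem fun h => lt_irrefl x (hD.2 h), pow_succ']

open Classical in
theorem chainPolyTop_eq (x : Q) :
    chainPolyTop x = X * (1 + ∑ y : Q with y < x, chainPolyTop y) := by
  rw [chainPolyTop_eq_mul, chainPolyIn_eq_add_sum (isLowerSet_Iio x)]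
  rfl

theorem chainPoly_eq : chainPoly Q = 1 + ∑ x : Q, chainPolyTop x := by
  classical
  rw [chainPoly_eq_chainPolyIn, chainPolyIn_eq_add_sum isLowerSet_univ]
  simp

end Chains

/-! ### Real-rootedness of chain polynomials -/

section RealRooted

open Classical in
/-- The generating polynomial of the chains with a fixed greatest element of rank `n`, in a poset
whose ranks are in `S` and whose principal ideals are enumerated by Gaussian binomial
coefficients. -/
noncomputable def chainTopSeq (q : ℕ) (S : Set ℕ) (n : ℕ) : ℝ[X] :=
  if n ∈ S then X * (1 + ∑ s : Fin n, (qBinom q n s : ℝ[X]) * chainTopSeq q S s) else 0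
termination_by n
decreasing_by exact s.2

theorem chainTopSeq_of_mem (q : ℕ) {S : Set ℕ} {n : ℕ} (h : n ∈ S) : chainTopSeq q S n =
    X * (1 + ∑ s ∈ Finset.range n, (qBinom q n s : ℝ[X]) * chainTopSeq q S s) := by
  rw [chainTopSeq, if_pos h, Finset.sum_range]

theorem chainTopSeq_of_notMem (q : ℕ) {S : Set ℕ} {n : ℕ} (h : n ∉ S) :
    chainTopSeq q S n = 0 := by
  rw [chainTopSeq, if_neg h]

open Classical in
theorem sum_eq_sum_range_card_mul {Q : Type*} [Fintype Q] (d : Q → ℕ) (p : Q → Prop) (m : ℕ)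
    (hm : ∀ x, p x → d x < m) {R : Type*} [CommSemiring R] (e : ℕ → R) :
    ∑ x : Q with p x, e (d x) =
      ∑ s ∈ Finset.range m, (Nat.card {x : Q // p x ∧ d x = s} : R) * e s := by
  rw [← Finset.sum_fiberwise_of_maps_to (t := Finset.range m) (g := d)
    (fun x hx => by simpa using hm x (by simpa using hx))]
  refine Finset.sum_congr rfl fun s _ => ?_
  rw [Finset.sum_congr rfl (g := fun _ => e s) (fun x hx => by rw [(Finset.mem_filter.1 hx).2]),
    Finset.sum_const, nsmul_eq_mul, Finset.filter_filter, Nat.card_eq_fintype_card,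
    Fintype.card_subtype]

variable {Q : Type*} [PartialOrder Q] {q : ℕ} {S : Set ℕ} {d : Q → ℕ}

theorem chainPolyTop_eq_chainTopSeq [Fintype Q] (hd : StrictMono d) (hS : ∀ x, d x ∈ S)
    (hlower : ∀ x, ∀ s ∈ S, s < d x → Nat.card {y : Q // y < x ∧ d y = s} = qBinom q (d x) s)
    (x : Q) : chainPolyTop x = chainTopSeq q S (d x) := by
  classical
  induction h : d x using Nat.strong_induction_on generalizing x with
  | _ n ih =>
    subst h
    rw [chainPolyTop_eq, chainTopSeq_of_mem q (hS x),
      Finset.sum_congr rfl (g := fun y => chainTopSeq q S (d y))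
        (fun y hy => ih _ (hd (Finset.mem_filter.1 hy).2) y rfl),
      sum_eq_sum_range_card_mul d (· < x) (d x) (fun y hy => hd hy)]
    congr 2
    refine Finset.sum_congr rfl fun s hs => ?_
    by_cases hsS : s ∈ S
    · rw [hlower x s hsS (Finset.mem_range.1 hs)]
    · rw [chainTopSeq_of_notMem q hsS, mul_zero, mul_zero]

/-- The `1` added at `n = 0` stands for the empty chain: it enters each recursion with coefficient
`qBinom q (n + 1) 0 = 1`. -/
theorem isChainValue_chainTopSeq (q : ℕ) (S : Set ℕ) {z : ℂ} (hz : 0 < z.im) :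
    IsChainValue q z fun n => aeval z (chainTopSeq q S n) + if n = 0 then 1 else 0 := by
  refine ⟨?_, fun n => ?_⟩
  · beta_reduce
    by_cases h : 0 ∈ S
    · rw [chainTopSeq_of_mem q h]
      simpa [add_comm] using one_add_ne_zero_of_im_pos hz
    · simp [chainTopSeq_of_notMem q h]
  · by_cases h : n + 1 ∈ S
    · right
      have : ∑ i ∈ Finset.range (n + 1), (qBinom q (n + 1) i : ℂ) * (if i = 0 then 1 else 0) = 1 := by
        simp
      simp only [mul_add, Finset.sum_add_distrib]
      rw [chainTopSeq_of_mem q h, ← mul_add, this]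
      simp [add_comm]
    · left
      simp [chainTopSeq_of_notMem q h]

/-- In the application to rank-selected posets, `d` is the rank in the ambient poset, so that `c`
and `r` do not depend on `S`. -/
theorem realRooted_chainPoly [Finite Q] (hq : 0 < q) (hd : StrictMono d) (hS : ∀ x, d x ∈ S)
    (hlower : ∀ x, ∀ s ∈ S, s < d x → Nat.card {y : Q // y < x ∧ d y = s} = qBinom q (d x) s)
    {r : ℕ} (hr : ∀ x, d x ≤ r) {c : ℕ → ℝ} (hc : ∀ k ≤ r, 0 ≤ c k) (hc0 : c 0 = 1)
    (hcard : ∀ s ∈ S, s ≤ r → (Nat.card {x : Q // d x = s} : ℝ) =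
      ∑ k ∈ Finset.range (r + 1), c k * resCoeff q r k s) :
    RealRooted (chainPoly Q) := by
  classical
  have := Fintype.ofFinite Q
  have hpoly : chainPoly Q = 1 + ∑ s ∈ Finset.range (r + 1),
      C (∑ k ∈ Finset.range (r + 1), c k * resCoeff q r k s) * chainTopSeq q S s := by
    rw [chainPoly_eq, Finset.sum_congr rfl
      fun x _ => chainPolyTop_eq_chainTopSeq hd hS hlower x]
    have := sum_eq_sum_range_card_mul d (fun _ => True) (r + 1)
      (fun x _ => Nat.lt_succ_of_le (hr x)) (chainTopSeq q S)
    simp only [true_and, Finset.filter_true] at this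
    rw [this]
    congr 1
    refine Finset.sum_congr rfl fun s hs => ?_
    by_cases hsS : s ∈ S
    · rw [← hcard s hsS (Nat.lt_succ_iff.1 (Finset.mem_range.1 hs))]
      simp
    · rw [chainTopSeq_of_notMem q hsS, mul_zero, mul_zero]
  have hne : ∀ z : ℂ, 0 < z.im → aeval z (chainPoly Q) ≠ 0 := by
    intro z hz
    have := (isChainValue_chainTopSeq q S hz).sum_ne_zero hz hq hc (hc0 ▸ one_pos)
    convert this using 1
    simp only [resValue, mul_add, Finset.sum_add_distrib]
    -- The empty chain contributes `c 0 = 1`, since only `R_{r,0}` has a nonzero constant term.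
    have h1 : ∑ k ∈ Finset.range (r + 1), (c k : ℂ) * ∑ i ∈ Finset.range (r + 1),
        (resCoeff q r k i : ℂ) * (if i = 0 then 1 else 0) = 1 := by
      rw [Finset.sum_eq_single 0]
      · simp [hc0]
      · intro k _ hk
        obtain ⟨j, rfl⟩ := Nat.exists_eq_succ_of_ne_zero hk
        simp
      · simp
    rw [h1, hpoly, add_comm, map_add, map_one, map_sum]
    congr 1
    simp only [map_mul, aeval_C, Finset.mul_sum]
    rw [Finset.sum_comm]
    refine Finset.sum_congr rfl fun s _ => ?_
    simp [Finset.sum_mul, mul_assoc]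
  intro z hz
  by_contra him
  rcases lt_or_gt_of_ne him with h | h
  · refine hne (starRingEnd ℂ z) (by simpa using h) ?_
    rw [aeval_conj, hz, map_zero]
  · exact hne z h hz

end RealRooted

/-! ### Counting subspaces -/

section Subspaces

open Module

variable {K V : Type*} [Field K] [AddCommGroup V] [Module K V]

theorem exists_between_finrank_eq [FiniteDimensional K V] {A B : Submodule K V} {m : ℕ}
    (hAB : A ≤ B) (hA : finrank K A ≤ m) (hB : m ≤ finrank K B) :
    ∃ H : Submodule K V, A ≤ H ∧ H ≤ B ∧ finrank K H = m := by
  induction m, hA using Nat.le_induction with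
  | base => exact ⟨A, le_rfl, hAB, rfl⟩
  | succ m hm ih =>
    obtain ⟨H, hAH, hHB, hH⟩ := ih (by omega)
    obtain ⟨v, hvB, hvH⟩ : ∃ v ∈ B, v ∉ H := by
      by_contra! h
      have := Submodule.finrank_mono (show B ≤ H from h)
      omega
    refine ⟨H ⊔ Submodule.span K {v}, hAH.trans le_sup_left, sup_le hHB ?_, ?_⟩
    · rwa [Submodule.span_singleton_le_iff_mem]
    · rw [Submodule.finrank_sup_span_singleton hvH, hH]

theorem finrank_eq_finrank_inf_add_one [FiniteDimensional K V] {H B x : Submodule K V}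
    (hB : finrank K B = finrank K H + 1) (hHB : H ≤ B) (hxB : x ≤ B) (hxH : ¬ x ≤ H) :
    finrank K x = finrank K (H ⊓ x : Submodule K V) + 1 := by
  have h1 := Submodule.finrank_lt_finrank_of_lt (left_lt_sup.2 hxH)
  have h2 := Submodule.finrank_mono (sup_le hHB hxB)
  have h3 := Submodule.finrank_sup_add_finrank_inf_eq H x
  omega

variable [Finite V]

open Classical in
/-- The subspaces between `A` and `B` that satisfy `p` and have codimension `k` over `A`. -/
noncomputable def subspacesBetween (p : Submodule K V → Prop) (A B : Submodule K V) (k : ℕ) :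
    Finset (Submodule K V) :=
  (Set.toFinite {x | A ≤ x ∧ x ≤ B ∧ p x ∧ finrank K x = finrank K A + k}).toFinset

theorem mem_subspacesBetween {p : Submodule K V → Prop} {A B x : Submodule K V} {k : ℕ} :
    x ∈ subspacesBetween p A B k ↔ A ≤ x ∧ x ≤ B ∧ p x ∧ finrank K x = finrank K A + k := by
  simp [subspacesBetween]

theorem card_subspacesBetween_succ (p : Submodule K V → Prop) {A H B : Submodule K V}
    (hHB : H ≤ B) (k : ℕ) : (subspacesBetween p A B k).card =
      (subspacesBetween p A H k).card +
        (subspacesBetween (fun x => p x ∧ ¬ x ≤ H) A B k).card := by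
  classical
  rw [← Finset.card_union_of_disjoint]
  · congr 1
    ext x
    simp only [Finset.mem_union, mem_subspacesBetween]
    have : x ≤ H → x ≤ B := fun h => h.trans hHB
    tauto
  · rw [Finset.disjoint_left]
    intro x
    simp only [mem_subspacesBetween]
    tauto

theorem subspacesBetween_zero {p : Submodule K V → Prop} {A B : Submodule K V} (hAB : A ≤ B)
    (hA : p A) : subspacesBetween p A B 0 = {A} := by
  ext x
  rw [mem_subspacesBetween, Finset.mem_singleton]
  constructor
  · rintro ⟨h1, -, -, h4⟩
    exact (Submodule.eq_of_le_of_finrank_le h1 h4.le).symm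
  · rintro rfl
    exact ⟨le_rfl, hAB, hA, rfl⟩

theorem card_filter_mem_notMem [Fintype V] {H B : Submodule K V} (hHB : H ≤ B) (hB : finrank K B = finrank K H + 1)
    [DecidablePred fun v : V => v ∈ B ∧ v ∉ H] :
    (Finset.univ.filter fun v : V => v ∈ B ∧ v ∉ H).card =
      Nat.card K ^ finrank K H * (Nat.card K - 1) := by
  have h1 : ((B : Set V) \ H).ncard = _ := Set.ncard_sdiff (s := (H : Set V)) hHB
  have h2 : ∀ W : Submodule K V, (W : Set V).ncard = Nat.card K ^ finrank K W := fun W => by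
    rw [← natCard_eq_pow_finrank (K := K) (V := W)]
    rfl
  rw [h2, h2, hB, pow_succ] at h1
  rw [Nat.mul_sub, mul_one, ← h1, ← Set.ncard_coe_finset]
  congr 1
  ext v
  simp

variable [Finite K]

/-- Each vector of `B \ H` spans with `A` one such space `A'`. As `H ⊓ A' = A`, the vectors giving
`A'` are exactly those of `A' \ A`; it remains to divide the two counts. -/
theorem card_subspacesBetween_one {A H B : Submodule K V} (hAH : A ≤ H) (hHB : H ≤ B)
    (hB : finrank K B = finrank K H + 1) :
    (subspacesBetween (fun x => ¬ x ≤ H) A B 1).card = Nat.card K ^ (finrank K H - finrank K A) := by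
  classical
  have := Fintype.ofFinite V
  have hmaps : ∀ v ∈ Finset.univ.filter fun v : V => v ∈ B ∧ v ∉ H,
      A ⊔ Submodule.span K {v} ∈ subspacesBetween (fun x => ¬ x ≤ H) A B 1 := by
    intro v hv
    simp only [Finset.mem_filter, Finset.mem_univ, true_and] at hv
    rw [mem_subspacesBetween]
    refine ⟨le_sup_left, sup_le (hAH.trans hHB) ?_, fun h => hv.2 ?_, ?_⟩
    · rw [Submodule.span_singleton_le_iff_mem]; exact hv.1
    · exact h (Submodule.mem_sup_right (Submodule.mem_span_singleton_self v))
    · exact Submodule.finrank_sup_span_singleton fun h => hv.2 (hAH h)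
  have hcount := Finset.card_eq_sum_card_fiberwise hmaps
  have hfiber : ∀ A' ∈ subspacesBetween (fun x => ¬ x ≤ H) A B 1,
      ((Finset.univ.filter fun v : V => v ∈ B ∧ v ∉ H).filter
        fun v => A ⊔ Submodule.span K {v} = A').card =
        Nat.card K ^ finrank K A * (Nat.card K - 1) := by
    intro A' hA'
    rw [mem_subspacesBetween] at hA'
    obtain ⟨hAA', hA'B, hA'H, hA'⟩ := hA'
    have hinf : H ⊓ A' = A := by
      refine (Submodule.eq_of_le_of_finrank_le (le_inf hAH hAA') ?_).symm
      have := finrank_eq_finrank_inf_add_one hB hHB hA'B hA'H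
      omega
    rw [← card_filter_mem_notMem hAA' hA', Finset.filter_filter]
    congr 1
    ext v
    simp only [Finset.mem_filter, Finset.mem_univ, true_and]
    constructor
    · rintro ⟨⟨-, hvH⟩, rfl⟩
      exact ⟨Submodule.mem_sup_right (Submodule.mem_span_singleton_self v), fun h => hvH (hAH h)⟩
    · rintro ⟨hvA', hvA⟩
      refine ⟨⟨hA'B hvA', fun h => hvA ?_⟩, ?_⟩
      · rw [← hinf]; exact ⟨h, hvA'⟩
      · refine Submodule.eq_of_le_of_finrank_le (sup_le hAA' ?_) ?_
        · rwa [Submodule.span_singleton_le_iff_mem]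
        · rw [Submodule.finrank_sup_span_singleton hvA, hA']
  rw [Finset.sum_congr rfl hfiber, card_filter_mem_notMem hHB hB, Finset.sum_const, smul_eq_mul,
    ← mul_assoc] at hcount
  have hq : 1 < Nat.card K := Finite.one_lt_card
  have hcount := Nat.eq_of_mul_eq_mul_right (by omega) hcount
  refine Nat.eq_of_mul_eq_mul_right (Nat.pow_pos (n := finrank K A) (by omega : 0 < Nat.card K)) ?_
  rw [← hcount, ← pow_add, Nat.sub_add_cancel (Submodule.finrank_mono hAH)]

/-- Double counting of the pairs `A' ≤ x`, where `A'` and `x` are not contained in the hyperplane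
`H` of `B`, and `A` has codimension one in `A'`. -/
theorem card_notLe_mul_pow (p : Submodule K V → Prop) {A H B : Submodule K V} (hAH : A ≤ H)
    (hHB : H ≤ B) (hB : finrank K B = finrank K H + 1) (k : ℕ) :
    (subspacesBetween (fun x => p x ∧ ¬ x ≤ H) A B (k + 1)).card * Nat.card K ^ k =
      ∑ A' ∈ subspacesBetween (fun x => ¬ x ≤ H) A B 1, (subspacesBetween p A' B k).card := by
  classical
  have hdouble := Finset.sum_card_bipartiteAbove_eq_sum_card_bipartiteBelow
    (s := subspacesBetween (fun x => p x ∧ ¬ x ≤ H) A B (k + 1))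
    (t := subspacesBetween (fun x => ¬ x ≤ H) A B 1) (fun x A' => A' ≤ x)
  rw [Finset.sum_congr rfl (g := fun _ => Nat.card K ^ k), Finset.sum_const, smul_eq_mul] at hdouble
  · rw [hdouble]
    refine Finset.sum_congr rfl fun A' hA' => ?_
    rw [mem_subspacesBetween] at hA'
    obtain ⟨hAA', hA'B, hA'H, hA'⟩ := hA'
    congr 1
    ext x
    simp only [Finset.mem_bipartiteBelow, mem_subspacesBetween]
    constructor
    · rintro ⟨⟨-, h2, ⟨h3, -⟩, h5⟩, h6⟩
      exact ⟨h6, h2, h3, by omega⟩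
    · rintro ⟨h1, h2, h3, h4⟩
      exact ⟨⟨hAA'.trans h1, h2, ⟨h3, fun h => hA'H (h1.trans h)⟩, by omega⟩, h1⟩
  · intro x hx
    rw [mem_subspacesBetween] at hx
    obtain ⟨hAx, hxB, ⟨-, hxH⟩, hx⟩ := hx
    have hinf := finrank_eq_finrank_inf_add_one hB hHB hxB hxH
    -- The `A'` below `x` are counted inside `x`, with `H ⊓ x` as the hyperplane.
    have := card_subspacesBetween_one (le_inf hAH hAx) inf_le_right hinf
    rw [show k = finrank K (H ⊓ x : Submodule K V) - finrank K A by omega, ← this]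
    congr 1
    ext A'
    simp only [Finset.mem_bipartiteAbove, mem_subspacesBetween]
    constructor
    · rintro ⟨⟨h1, h2, h3, h4⟩, h5⟩
      exact ⟨h1, h5, fun h => h3 (h.trans inf_le_left), h4⟩
    · rintro ⟨h1, h2, h3, h4⟩
      exact ⟨⟨h1, h2.trans hxB, fun h => h3 (le_inf h h2), h4⟩, h2⟩

/-- Splitting along a hyperplane and double counting the spaces outside it reproduces the q-Pascal
rule. -/
theorem card_subspacesBetween_true {A B : Submodule K V} (hAB : A ≤ B) (k : ℕ) :
    (subspacesBetween (fun _ => True) A B k).card =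
      qBinom (Nat.card K) (finrank K B - finrank K A) k := by
  induction hn : finrank K B - finrank K A generalizing A B k with
  | zero =>
    have hle := Submodule.finrank_mono hAB
    obtain rfl := Submodule.eq_of_le_of_finrank_le hAB (by omega)
    cases k with
    | zero => rw [subspacesBetween_zero le_rfl trivial]; simp
    | succ k =>
      rw [qBinom_eq_zero_of_lt _ (Nat.succ_pos k), Finset.card_eq_zero,
        Finset.eq_empty_iff_forall_notMem]
      intro x hx
      obtain ⟨h1, h2, -, h4⟩ := mem_subspacesBetween.1 hx
      have := Submodule.finrank_mono h2
      omega
  | succ n ih =>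
    cases k with
    | zero => rw [subspacesBetween_zero hAB trivial]; simp
    | succ k =>
      have hq : 0 < Nat.card K := Nat.card_pos
      obtain ⟨H, hAH, hHB, hH⟩ := exists_between_finrank_eq (m := finrank K A + n) hAB
        (by omega) (by omega)
      have hB : finrank K B = finrank K H + 1 := by omega
      have h1 := card_notLe_mul_pow (fun _ => True) hAH hHB hB k
      rw [Finset.sum_congr rfl (g := fun _ => qBinom (Nat.card K) n k), Finset.sum_const,
        card_subspacesBetween_one hAH hHB hB, smul_eq_mul,
        show finrank K H - finrank K A = n by omega] at h1
      · rw [card_subspacesBetween_succ _ hHB, ih hAH _ (by omega), qBinom_succ_succ, add_comm]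
        congr 1
        refine Nat.eq_of_mul_eq_mul_right (Nat.pow_pos (n := k) hq) ?_
        rw [h1]
        rcases le_or_gt k n with hk | hk
        · rw [mul_right_comm, ← pow_add, Nat.sub_add_cancel hk]
        · rw [qBinom_eq_zero_of_lt _ hk]; simp
      · intro A' hA'
        obtain ⟨h1, h2, h3, h4⟩ := mem_subspacesBetween.1 hA'
        exact ih h2 k (by omega)

end Subspaces

/-! ### Independent spaces of `q`-matroids -/

section QMatroid

open Module

/-- The sequences of coefficients of the nonnegative combinations of `R_{r,0}(t), …, R_{r,r}(t)`. -/
def IsNonnegCombination (q r : ℕ) (f : ℕ → ℝ) : Prop :=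
  ∃ h : ℕ → ℝ, (∀ k ≤ r, 0 ≤ h k) ∧
    ∀ i, f i = ∑ k ∈ Finset.range (r + 1), h k * resCoeff q r k i

theorem IsNonnegCombination.zero (q r : ℕ) : IsNonnegCombination q r 0 :=
  ⟨0, fun _ _ => le_rfl, fun i => by simp⟩

theorem IsNonnegCombination.add {q r : ℕ} {f g : ℕ → ℝ} (hf : IsNonnegCombination q r f)
    (hg : IsNonnegCombination q r g) : IsNonnegCombination q r (f + g) := by
  obtain ⟨a, ha, hfa⟩ := hf
  obtain ⟨b, hb, hgb⟩ := hg
  refine ⟨a + b, fun k hk => add_nonneg (ha k hk) (hb k hk), fun i => ?_⟩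
  simp [hfa, hgb, add_mul, Finset.sum_add_distrib]

theorem IsNonnegCombination.sum {q r : ℕ} {ι : Type*} (s : Finset ι) {f : ι → ℕ → ℝ}
    (hf : ∀ j ∈ s, IsNonnegCombination q r (f j)) : IsNonnegCombination q r (∑ j ∈ s, f j) :=
  Finset.sum_induction f (IsNonnegCombination q r) (fun _ _ => .add) (.zero q r) hf

/-- The double count determines `g (i + 1)` as `q^(-i) f i`. Since `R_{r+1,k+1}` has coefficients
`q^(r-i)` times those of `R_{r,k}`, moving `h` up by one index and dividing by `q^r` gives the
expansion of `g`. -/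
theorem IsNonnegCombination.shift {q r : ℕ} (hq : 0 < q) {f g : ℕ → ℝ}
    (hf : IsNonnegCombination q r f) (hg0 : g 0 = 0) (hg : ∀ i, g (i + 1) * (q : ℝ) ^ i = f i) :
    IsNonnegCombination q (r + 1) g := by
  obtain ⟨h, hh, hfh⟩ := hf
  have hq' : (q : ℝ) ≠ 0 := by positivity
  refine ⟨fun k => if k = 0 then 0 else h (k - 1) * ((q : ℝ) ^ r)⁻¹, fun k hk => ?_, fun i => ?_⟩
  · beta_reduce
    split_ifs with h0
    · exact le_rfl
    · exact mul_nonneg (hh _ (by omega)) (by positivity)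
  · rw [Finset.sum_range_succ']
    cases i with
    | zero => simp [hg0]
    | succ i =>
      refine mul_right_cancel₀ (pow_ne_zero i hq') ?_
      rw [hg, hfh]
      simp only [Nat.add_eq_zero_iff, one_ne_zero, and_false, if_false, if_true, zero_mul,
        add_zero, Nat.add_sub_cancel, resCoeff_succ, Finset.sum_mul]
      refine Finset.sum_congr rfl fun k _ => ?_
      rcases le_or_gt i r with hi | hi
      · push_cast
        rw [pow_sub₀ _ hq' hi]
        field_simp
      · rw [resCoeff_eq_zero_of_lt_right q hi]; simp

variable {K : Type*} [Field K] {n : ℕ} {φ : Submodule K (Fin n → K) → ℕ}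

/-- Submodularity for `y` and a complement of `y` in `x` bounds `dim x` by the sum of their ranks,
which forces both to have full rank. -/
theorem IsQMatroid.indep_of_le (hφ : IsQMatroid φ) {x y : Submodule K (Fin n → K)}
    (hx : φ x = finrank K x) (hyx : y ≤ x) : φ y = finrank K y := by
  obtain ⟨w, hw⟩ := exists_isCompl y
  have hsup : y ⊔ (w ⊓ x) = x := by
    rw [← sup_inf_assoc_of_le _ hyx, hw.sup_eq_top, top_inf_eq]
  have hinf : y ⊓ (w ⊓ x) = ⊥ := by
    rw [← inf_assoc, hw.inf_eq_bot, bot_inf_eq]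
  have h1 := hφ.submodular y (w ⊓ x)
  have h2 := Submodule.finrank_sup_add_finrank_inf_eq y (w ⊓ x)
  rw [hsup, hinf] at h1 h2
  rw [finrank_bot] at h2
  have h3 := hφ.le_dim y
  have h4 := hφ.le_dim (w ⊓ x)
  omega

/-- A maximal independent space below `B` has the rank of `B`. -/
theorem IsQMatroid.exists_basis (hφ : IsQMatroid φ) {A B : Submodule K (Fin n → K)}
    (hA : φ A = finrank K A) (hAB : A ≤ B) :
    ∃ x, A ≤ x ∧ x ≤ B ∧ φ x = finrank K x ∧ φ x = φ B := by
  induction hm : finrank K B - finrank K A using Nat.strong_induction_on generalizing A with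
  | _ m ih =>
    by_cases hex : ∃ v ∈ B, φ (A ⊔ Submodule.span K {v}) ≠ φ A
    · obtain ⟨v, hvB, hv⟩ := hex
      have hvA : v ∉ A := fun h => hv (by
        rw [sup_eq_left.2 ((Submodule.span_singleton_le_iff_mem v A).2 h)])
      have hle : A ⊔ Submodule.span K {v} ≤ B :=
        sup_le hAB ((Submodule.span_singleton_le_iff_mem v B).2 hvB)
      have hfr := Submodule.finrank_sup_span_singleton hvA
      have h1 := hφ.le_dim (A ⊔ Submodule.span K {v})
      have h2 := hφ.mono A (A ⊔ Submodule.span K {v}) le_sup_left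
      have h3 := Submodule.finrank_mono hle
      obtain ⟨x, hx1, hx2⟩ := ih _ (by omega) (by omega) hle rfl
      exact ⟨x, le_sup_left.trans hx1, hx2⟩
    · push Not at hex
      refine ⟨A, le_rfl, hAB, hA, ?_⟩
      -- No single vector of `B` raises the rank of `A`. By submodularity, adding it to a space `y`
      -- above `A` of rank `φ A` does not raise the rank either, so a maximal such `y` is `B`.
      obtain ⟨y, hy, hmax⟩ : ∃ y : Submodule K (Fin n → K), (A ≤ y ∧ y ≤ B ∧ φ y = φ A) ∧
          ∀ z : Submodule K (Fin n → K), A ≤ z ∧ z ≤ B ∧ φ z = φ A → ¬ y < z := by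
        obtain ⟨y, hy, hmax⟩ := WellFounded.has_min
          (wellFounded_gt : WellFounded ((· > ·) : Submodule K (Fin n → K) → _ → Prop))
          {y | A ≤ y ∧ y ≤ B ∧ φ y = φ A} ⟨A, le_rfl, hAB, rfl⟩
        exact ⟨y, hy, hmax⟩
      suffices hBy : B ≤ y by rw [le_antisymm hBy hy.2.1, hy.2.2]
      intro v hv
      by_contra hvy
      have h1 := hex v hv
      have h2 := hφ.submodular y (A ⊔ Submodule.span K {v})
      have hAinf : A ≤ y ⊓ (A ⊔ Submodule.span K {v}) := le_inf hy.1 le_sup_left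
      have h3 := hφ.mono _ _ hAinf
      have h4 := hφ.mono _ _ (le_sup_left : y ≤ y ⊔ (A ⊔ Submodule.span K {v}))
      have hvmem : v ∈ y ⊔ (A ⊔ Submodule.span K {v}) :=
        Submodule.mem_sup_right (Submodule.mem_sup_right (Submodule.mem_span_singleton_self v))
      refine hmax (y ⊔ (A ⊔ Submodule.span K {v})) ⟨hy.1.trans le_sup_left, ?_, by omega⟩ ?_
      · exact sup_le hy.2.1 (sup_le hAB ((Submodule.span_singleton_le_iff_mem v B).2 hv))
      · exact lt_of_le_of_ne le_sup_left fun h => hvy (h ▸ hvmem)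

theorem IsQMatroid.isNonnegCombination [Finite K] (hφ : IsQMatroid φ)
    {A B : Submodule K (Fin n → K)} (hA : φ A = finrank K A) (hAB : A ≤ B) :
    IsNonnegCombination (Nat.card K) (φ B - finrank K A)
      fun i => ((subspacesBetween (fun x => φ x = finrank K x) A B i).card : ℝ) := by
  induction hm : finrank K B - finrank K A using Nat.strong_induction_on generalizing A B with
  | _ m ih =>
    have hq : 0 < Nat.card K := Nat.card_pos
    by_cases hBi : φ B = finrank K B
    · refine ⟨fun k => if k = 0 then 1 else 0, fun k _ => ?_, fun i => ?_⟩
      · beta_reduce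
        split_ifs <;> norm_num
      · have : subspacesBetween (fun x => φ x = finrank K x) A B i =
            subspacesBetween (fun _ => True) A B i := by
          ext x
          simp only [mem_subspacesBetween, true_and]
          exact ⟨fun h => ⟨h.1, h.2.1, h.2.2.2⟩,
            fun h => ⟨h.1, h.2.1, hφ.indep_of_le hBi h.2.1, h.2.2⟩⟩
        beta_reduce
        rw [this, card_subspacesBetween_true hAB, hBi]
        simp
    · obtain ⟨x, hAx, hxB, hxi, hxφ⟩ := hφ.exists_basis hA hAB
      have hBlt : φ B < finrank K B := lt_of_le_of_ne (hφ.le_dim B) hBi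
      -- Containing a basis of `B`, this hyperplane has the rank of `B`, so both parts of the split
      -- are combinations for the same `r`.
      obtain ⟨H, hxH, hHB, hH⟩ := exists_between_finrank_eq (m := finrank K B - 1) hxB
        (by omega) (by omega)
      have hAH := hAx.trans hxH
      have hB : finrank K B = finrank K H + 1 := by omega
      have hHφ : φ H = φ B := le_antisymm (hφ.mono _ _ hHB) (hxφ ▸ hφ.mono _ _ hxH)
      have hAHf := Submodule.finrank_mono hAH
      have h1 := ih _ (by omega) hA hAH rfl
      rw [hHφ] at h1
      have hsplit : (fun i => ((subspacesBetween (fun x => φ x = finrank K x) A B i).card : ℝ)) =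
          (fun i => ((subspacesBetween (fun x => φ x = finrank K x) A H i).card : ℝ)) +
          fun i => ((subspacesBetween (fun x => φ x = finrank K x ∧ ¬ x ≤ H) A B i).card : ℝ) := by
        ext i
        rw [card_subspacesBetween_succ _ hHB i]
        simp
      rw [hsplit]
      refine h1.add ?_
      have hzero : subspacesBetween (fun x => φ x = finrank K x ∧ ¬ x ≤ H) A B 0 = ∅ := by
        rw [Finset.eq_empty_iff_forall_notMem]
        intro y hy
        obtain ⟨h1, -, ⟨-, h3⟩, h4⟩ := mem_subspacesBetween.1 hy
        exact h3 (Submodule.eq_of_le_of_finrank_le h1 h4.le ▸ hAH)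
      have hdep : ∀ A' ∈ subspacesBetween (fun x => ¬ x ≤ H) A B 1, φ A' ≠ finrank K A' →
          ∀ i, subspacesBetween (fun x => φ x = finrank K x) A' B i = ∅ := by
        intro A' _ hA' i
        rw [Finset.eq_empty_iff_forall_notMem]
        intro y hy
        obtain ⟨h1, -, h3, -⟩ := mem_subspacesBetween.1 hy
        exact hA' (hφ.indep_of_le h3 h1)
      have hcount := card_notLe_mul_pow (fun x => φ x = finrank K x) hAH hHB hB
      -- When `φ B = dim A`, every `A'` has dimension above `φ B` and is dependent, so nothing
      -- independent lies outside `H`.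
      rcases Nat.eq_zero_or_pos (φ B - finrank K A) with hr | hr
      · have : (fun i => ((subspacesBetween (fun x => φ x = finrank K x ∧ ¬ x ≤ H) A B i).card : ℝ))
            = 0 := by
          ext i
          cases i with
          | zero => simp [hzero]
          | succ i =>
            rw [Pi.zero_apply, Nat.cast_eq_zero]
            refine (Nat.mul_eq_zero.1 ((hcount i).trans ?_)).resolve_right
              (Nat.pow_pos hq).ne'
            refine Finset.sum_eq_zero fun A' hA' => ?_
            rw [hdep A' hA' (fun h => ?_), Finset.card_empty]
            obtain ⟨-, h2, -, h4⟩ := mem_subspacesBetween.1 hA'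
            have := hφ.mono _ _ h2
            omega
        rw [this]
        exact .zero _ _
      · obtain ⟨r, hr⟩ : ∃ r, φ B - finrank K A = r + 1 := ⟨φ B - finrank K A - 1, by omega⟩
        rw [hr]
        refine IsNonnegCombination.shift hq
          (f := ∑ A' ∈ subspacesBetween (fun x => ¬ x ≤ H) A B 1, fun i =>
            ((subspacesBetween (fun x => φ x = finrank K x) A' B i).card : ℝ))
          (.sum _ fun A' hA' => ?_) (by simp [hzero]) fun i => ?_
        · obtain ⟨g1, g2, -, g4⟩ := mem_subspacesBetween.1 hA'
          by_cases hA'i : φ A' = finrank K A'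
          · have := ih _ (by omega) hA'i g2 rfl
            rwa [show φ B - finrank K A' = r by omega] at this
          · simp only [hdep A' hA' hA'i, Finset.card_empty, Nat.cast_zero]
            exact .zero _ _
        · rw [Finset.sum_apply]
          exact_mod_cast hcount i

end QMatroid

/-! ### Ranks and counts in the poset of subspaces and in the poset of independent spaces -/

theorem rho_eq_of_strictMono {P : Type*} [PartialOrder P] {d : P → ℕ} (hd : StrictMono d)
    (h : ∀ x, ∀ b < d x, ∃ y < x, d y = b) (x : P) : rho x = d x := by
  rw [rho, Order.height_eq_of_strictMono d hd h, Order.height_nat]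
  rfl

theorem coeff_finsum_X_pow {T : Type*} [Finite T] (d : T → ℕ) (i : ℕ) :
    (∑ᶠ x : T, (X : ℝ[X]) ^ d x).coeff i = (Nat.card {x : T // d x = i} : ℝ) := by
  classical
  have := Fintype.ofFinite T
  rw [finsum_eq_sum_of_fintype, finsetSum_coeff, Nat.card_eq_fintype_card, Fintype.card_subtype]
  simp only [coeff_X_pow, Finset.sum_boole, eq_comm]

section RankSelected

variable {Q : Type*} [PartialOrder Q] {S : Set ℕ}

theorem card_rankSelected_lt (x : RankSelected Q S) {s : ℕ} (hs : s ∈ S) (hsx : s < rho x.1) :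
    Nat.card {y : RankSelected Q S // y < x ∧ rho y.1 = s} = lowerCount x.1 s :=
  Nat.card_congr
    { toFun := fun y => ⟨y.1.1, y.2.1.le, y.2.2⟩
      invFun := fun z => ⟨⟨z.1, z.2.2.symm ▸ hs⟩, lt_of_le_of_ne z.2.1 fun h =>
        hsx.ne (by rw [← h]; exact z.2.2.symm), z.2.2⟩ }

theorem card_lt_eq_lowerCount (x : Q) {s : ℕ} (hsx : s < rho x) :
    Nat.card {y : Q // y < x ∧ rho y = s} = lowerCount x s :=
  Nat.card_congr (Equiv.subtypeEquivRight fun _ =>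
    ⟨fun h => ⟨h.1.le, h.2⟩, fun h => ⟨lt_of_le_of_ne h.1 fun e => hsx.ne (e ▸ h.2.symm), h.2⟩⟩)

theorem card_rankSelected {s : ℕ} (hs : s ∈ S) :
    Nat.card {y : RankSelected Q S // rho y.1 = s} = Nat.card {y : Q // rho y = s} :=
  Nat.card_congr
    { toFun := fun y => ⟨y.1.1, y.2⟩
      invFun := fun z => ⟨⟨z.1, z.2.symm ▸ hs⟩, z.2⟩ }

end RankSelected

/-! ### The poset of finite dimensional subspaces -/

namespace SubspacePoset

open Module

variable {K : Type*} [Field K]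

theorem rho_eq (x : SubspacePoset K) : rho x = finrank K x.1 := by
  refine rho_eq_of_strictMono (d := fun x : SubspacePoset K => finrank K x.1) ?_ ?_ x
  · intro x y hxy
    have := y.2
    exact Submodule.finrank_lt_finrank_of_lt hxy
  · intro x b hb
    have := x.2
    obtain ⟨W, -, -, hW⟩ := exists_between_finrank_eq (K := K) (V := x.1) (A := ⊥) (B := ⊤) (m := b)
      bot_le (by simp) (by rw [finrank_top]; exact hb.le)
    have hWb : finrank K (W.map x.1.subtype) = b := by
      rw [Submodule.finrank_map_subtype_eq, hW]
    have hle : W.map x.1.subtype ≤ x.1 := Submodule.map_subtype_le _ _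
    refine ⟨⟨W.map x.1.subtype, Submodule.finiteDimensional_of_le hle⟩,
      lt_of_le_of_ne hle fun h => hb.ne ?_, hWb⟩
    rw [← hWb]
    exact congrArg (fun y : SubspacePoset K => finrank K y.1) h

theorem lowerCount_eq [Finite K] (x : SubspacePoset K) (k : ℕ) :
    lowerCount x k = qBinom (Nat.card K) (rho x) k := by
  have := x.2
  have : Finite x.1 := Module.finite_of_finite K
  have h := card_subspacesBetween_true (K := K) (V := x.1) (A := ⊥) (B := ⊤) bot_le k
  rw [finrank_top, finrank_bot, Nat.sub_zero, ← rho_eq] at h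
  rw [lowerCount, ← h, ← Nat.card_eq_finsetCard]
  have hle : ∀ W : Submodule K x.1, W.map x.1.subtype ≤ x.1 := Submodule.map_subtype_le x.1
  have hrho : ∀ W : subspacesBetween (K := K) (V := x.1) (fun _ => True) ⊥ ⊤ k,
      rho (⟨W.1.map x.1.subtype, Submodule.finiteDimensional_of_le (hle W.1)⟩ :
        SubspacePoset K) = k := fun W => by
    rw [rho_eq, Submodule.finrank_map_subtype_eq, (mem_subspacesBetween.1 W.2).2.2.2,
      finrank_bot, zero_add]
  refine (Nat.card_congr (Equiv.ofBijective
    (fun W => ⟨⟨W.1.map x.1.subtype, Submodule.finiteDimensional_of_le (hle W.1)⟩, hle W.1,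
      hrho W⟩) ⟨?_, ?_⟩)).symm
  · intro W W' h
    refine Subtype.ext (Submodule.map_injective_of_injective x.1.subtype_injective ?_)
    exact congrArg (fun z => z.1.1) h
  · rintro ⟨z, hz, hzk⟩
    have hmap : (z.1.comap x.1.subtype).map x.1.subtype = z.1 := by
      rw [Submodule.map_comap_subtype, inf_eq_right.2 hz]
    refine ⟨⟨z.1.comap x.1.subtype, mem_subspacesBetween.2 ⟨bot_le, le_top, trivial, ?_⟩⟩,
      Subtype.ext (Subtype.ext hmap)⟩
    rw [← Submodule.finrank_map_subtype_eq, hmap, ← rho_eq, hzk,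
      finrank_bot, zero_add]

theorem exists_rho_eq (K : Type*) [Field K] (n : ℕ) : ∃ x : SubspacePoset K, rho x = n := by
  cases n with
  | zero => exact ⟨⟨⊥, inferInstance⟩, by rw [rho_eq]; simp⟩
  | succ n =>
    -- The sequences of period `n + 1` form a subspace of dimension `n + 1`.
    let f : (Fin (n + 1) → K) →ₗ[K] (ℕ → K) := LinearMap.funLeft K K (Fin.ofNat (n + 1))
    have hf : Function.Injective f := LinearMap.funLeft_injective_of_surjective K K _
      fun i => ⟨i, by simp⟩
    refine ⟨⟨LinearMap.range f, inferInstance⟩, ?_⟩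
    rw [rho_eq, LinearMap.finrank_range_of_inj hf, Module.finrank_fin_fun]

theorem quasiRank_eq (K : Type*) [Field K] : quasiRank (SubspacePoset K) = ⊤ := by
  rw [quasiRank, ENat.eq_top_iff_forall_ge]
  intro n
  obtain ⟨x, hx⟩ := exists_rho_eq K n
  exact hx ▸ le_iSup (fun x : SubspacePoset K => (rho x : ℕ∞)) x

theorem rankMatrix_eq (K : Type*) [Field K] [Finite K] (n k : ℕ) :
    rankMatrix (SubspacePoset K) n k = qBinom (Nat.card K) n k := by
  have h := exists_rho_eq K n
  rw [rankMatrix, dif_pos h, lowerCount_eq, h.choose_spec]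

theorem isQuasiRankUniform (K : Type*) [Field K] [Finite K] :
    IsQuasiRankUniform (SubspacePoset K) where
  locallyFinite x y := by
    have := y.2
    have : Finite y.1 := Module.finite_of_finite K
    refine Set.Finite.of_injOn (f := fun z : SubspacePoset K => z.1.comap y.1.subtype)
      (t := Set.univ) (Set.mapsTo_univ _ _) ?_ Set.finite_univ
    intro z hz w hw h
    have h' := congrArg (Submodule.map y.1.subtype) h
    simp only [Submodule.map_comap_subtype] at h'
    rw [inf_eq_right.2 hz.2, inf_eq_right.2 hw.2] at h'
    exact Subtype.ext h'
  exists_bot := ⟨⟨⊥, inferInstance⟩, fun x => (bot_le : ⊥ ≤ x.1)⟩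
  uniform x y h k _ := by rw [lowerCount_eq, lowerCount_eq, h]

theorem isTNPoset (K : Type*) [Field K] [Finite K] : IsTNPoset (SubspacePoset K) where
  quasiRankUniform := isQuasiRankUniform K
  totallyNonneg := isTotallyNonneg_qBinom Nat.card_pos _ _ (rankMatrix_eq K)

theorem resolves (K : Type*) [Field K] [Finite K] :
    Resolves (quasiRank (SubspacePoset K)) (rankMatrix (SubspacePoset K))
      (fun _ k => (Nat.card K : ℝ) ^ k) (resPoly (Nat.card K)) :=
  resolves_qBinom Nat.card_pos _ _ (rankMatrix_eq K)

end SubspacePoset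

/-! ### The poset of independent spaces of a q-matroid -/

namespace IsQMatroid

open Module

variable {K : Type*} [Field K] {n : ℕ} {φ : Submodule K (Fin n → K) → ℕ}

theorem strictMono_finrank :
    StrictMono fun x : IndependentSpaces φ => finrank K x.1 :=
  fun _ _ h => Submodule.finrank_lt_finrank_of_lt h

theorem indep_bot (hφ : IsQMatroid φ) : φ ⊥ = finrank K (⊥ : Submodule K (Fin n → K)) := by
  have := hφ.le_dim ⊥
  rw [finrank_bot] at this ⊢
  omega

theorem rho_eq (hφ : IsQMatroid φ) (x : IndependentSpaces φ) : rho x = finrank K x.1 := by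
  refine rho_eq_of_strictMono strictMono_finrank (fun x b hb => ?_) x
  obtain ⟨y, -, hyx, hy⟩ := exists_between_finrank_eq (A := ⊥) (B := x.1) (m := b)
    bot_le (by simp) hb.le
  refine ⟨⟨y, hφ.indep_of_le x.2 hyx⟩, lt_of_le_of_ne hyx fun h => hb.ne ?_, hy⟩
  rw [← hy]
  exact congrArg (fun y : IndependentSpaces φ => finrank K y.1) h

theorem rho_le (hφ : IsQMatroid φ) (x : IndependentSpaces φ) : rho x ≤ φ ⊤ := by
  rw [hφ.rho_eq, ← x.2]
  exact hφ.mono _ _ le_top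

theorem quasiRank_eq (hφ : IsQMatroid φ) : quasiRank (IndependentSpaces φ) = (φ ⊤ : ℕ∞) := by
  refine le_antisymm (iSup_le fun x => by exact_mod_cast hφ.rho_le x) ?_
  obtain ⟨x, -, -, hx, hxφ⟩ := hφ.exists_basis hφ.indep_bot bot_le (B := ⊤)
  rw [← hxφ, hx, ← hφ.rho_eq ⟨x, hx⟩]
  exact le_iSup (fun x : IndependentSpaces φ => (rho x : ℕ∞)) ⟨x, hx⟩

theorem strictMono_rho (hφ : IsQMatroid φ) : StrictMono fun x : IndependentSpaces φ => rho x := by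
  intro x y h
  simp only [hφ.rho_eq]
  exact strictMono_finrank h

variable [Finite K]

theorem card_rho_eq (hφ : IsQMatroid φ) (k : ℕ) :
    Nat.card {x : IndependentSpaces φ // rho x = k} =
      (subspacesBetween (fun x => φ x = finrank K x) ⊥ ⊤ k).card := by
  rw [← Nat.card_eq_finsetCard]
  exact Nat.card_congr
    { toFun := fun x => ⟨x.1.1, mem_subspacesBetween.2
        ⟨bot_le, le_top, x.1.2, by rw [← hφ.rho_eq, x.2, finrank_bot, zero_add]⟩⟩
      invFun := fun y => ⟨⟨y.1, (mem_subspacesBetween.1 y.2).2.2.1⟩, by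
        rw [hφ.rho_eq, (mem_subspacesBetween.1 y.2).2.2.2, finrank_bot, zero_add]⟩ }

theorem lowerCount_eq (hφ : IsQMatroid φ) (x : IndependentSpaces φ) (k : ℕ) :
    lowerCount x k = qBinom (Nat.card K) (rho x) k := by
  have h := card_subspacesBetween_true (K := K) (A := ⊥) (B := x.1) bot_le k
  rw [finrank_bot, Nat.sub_zero, ← hφ.rho_eq] at h
  rw [lowerCount, ← h, ← Nat.card_eq_finsetCard]
  exact Nat.card_congr
    { toFun := fun z => ⟨z.1.1, mem_subspacesBetween.2
        ⟨bot_le, z.2.1, trivial, by rw [← hφ.rho_eq, z.2.2, finrank_bot, zero_add]⟩⟩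
      invFun := fun y => ⟨⟨y.1, hφ.indep_of_le x.2 (mem_subspacesBetween.1 y.2).2.1⟩,
        (mem_subspacesBetween.1 y.2).2.1, by
        rw [hφ.rho_eq, (mem_subspacesBetween.1 y.2).2.2.2, finrank_bot, zero_add]⟩ }

/-- The nonnegative coefficients of the rank generating polynomial of the independent spaces. -/
theorem exists_coeffs (hφ : IsQMatroid φ) : ∃ h : ℕ → ℝ, (∀ k ≤ φ ⊤, 0 ≤ h k) ∧ h 0 = 1 ∧
    ∀ i, (Nat.card {x : IndependentSpaces φ // rho x = i} : ℝ) =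
      ∑ k ∈ Finset.range (φ ⊤ + 1), h k * resCoeff (Nat.card K) (φ ⊤) k i := by
  obtain ⟨h, hh, hcoeff⟩ := hφ.isNonnegCombination hφ.indep_bot (bot_le (a := ⊤))
  rw [finrank_bot, Nat.sub_zero] at hh hcoeff
  refine ⟨h, hh, ?_, fun i => by rw [hφ.card_rho_eq]; exact hcoeff i⟩
  -- At `i = 0` the count is `1`, from the zero space, and only `R_{r,0}` contributes.
  have := hcoeff 0
  beta_reduce at this
  rw [subspacesBetween_zero bot_le hφ.indep_bot, Finset.sum_range_succ'] at this
  simpa using this.symm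

theorem isQuasiRankUniform (hφ : IsQMatroid φ) : IsQuasiRankUniform (IndependentSpaces φ) where
  locallyFinite _ _ := Set.toFinite _
  exists_bot := ⟨⟨⊥, hφ.indep_bot⟩, fun x => (bot_le : ⊥ ≤ x.1)⟩
  uniform x y h k _ := by rw [hφ.lowerCount_eq, hφ.lowerCount_eq, h]

theorem isCombinatorialPoset (hφ : IsQMatroid φ) :
    IsCombinatorialPoset (SubspacePoset K) (IndependentSpaces φ) where
  quasiRankUniform := hφ.isQuasiRankUniform
  rank_le y := by rw [SubspacePoset.quasiRank_eq]; exact le_top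
  sum_eq y := by
    rw [← (SubspacePoset.resolves K).row _ (by rw [SubspacePoset.quasiRank_eq]; exact le_top)]
    ext i
    rw [coeff_finsum_X_pow (fun x : {x : IndependentSpaces φ // x ≤ y} => rho x.1), coeff_resPoly,
      resCoeff_zero_mid, ← hφ.lowerCount_eq, lowerCount]
    congr 1
    exact Nat.card_congr (Equiv.subtypeSubtypeEquivSubtypeInter (· ≤ y) fun x => rho x = i)

theorem isPositive (hφ : IsQMatroid φ) :
    IsPositive (SubspacePoset K) (IndependentSpaces φ) where
  isTNPoset := SubspacePoset.isTNPoset K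
  isCombinatorialPoset := hφ.isCombinatorialPoset
  expansion := by
    obtain ⟨h, hh, -, hcoeff⟩ := hφ.exists_coeffs
    refine ⟨_, _, φ ⊤, h, SubspacePoset.resolves K, hφ.quasiRank_eq, hh, ?_⟩
    ext i
    rw [rankGenPoly, coeff_finsum_X_pow (fun x : IndependentSpaces φ => rho x), hcoeff,
      finsetSum_coeff]
    simp only [coeff_C_mul, coeff_resPoly]

theorem realRooted_chainPoly (hφ : IsQMatroid φ) : RealRooted (chainPoly (IndependentSpaces φ)) := by
  obtain ⟨h, hh, h0, hcoeff⟩ := hφ.exists_coeffs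
  exact TNPoset.realRooted_chainPoly (S := Set.univ) Nat.card_pos hφ.strictMono_rho
    (fun _ => Set.mem_univ _)
    (fun x s _ hs => by rw [card_lt_eq_lowerCount x hs, hφ.lowerCount_eq])
    hφ.rho_le hh h0 fun s _ _ => hcoeff s

theorem realRooted_chainPoly_rankSelected (hφ : IsQMatroid φ) (S : Set ℕ) :
    RealRooted (chainPoly (RankSelected (IndependentSpaces φ) S)) := by
  obtain ⟨h, hh, h0, hcoeff⟩ := hφ.exists_coeffs
  exact TNPoset.realRooted_chainPoly (d := fun x : RankSelected (IndependentSpaces φ) S => rho x.1)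
    Nat.card_pos (fun _ _ hxy => hφ.strictMono_rho hxy) (fun x => x.2)
    (fun x s hsS hs => by rw [card_rankSelected_lt x hsS hs, hφ.lowerCount_eq])
    (fun x => hφ.rho_le x.1) hh h0 fun s hs _ => by rw [card_rankSelected hs]; exact hcoeff s

end IsQMatroid

end TNPoset

theorem theorem7 {K : Type*} [Field K] [Finite K] {n : ℕ}
    (φ : Submodule K (Fin n → K) → ℕ) (hφ : TNPoset.IsQMatroid φ) :
    TNPoset.IsPositive (TNPoset.SubspacePoset K) (TNPoset.IndependentSpaces φ) ∧
    TNPoset.RealRooted (TNPoset.chainPoly (TNPoset.IndependentSpaces φ)) ∧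
    ∀ S : Set ℕ, TNPoset.RealRooted
      (TNPoset.chainPoly (TNPoset.RankSelected (TNPoset.IndependentSpaces φ) S)) :=
  ⟨hφ.isPositive, hφ.realRooted_chainPoly, hφ.realRooted_chainPoly_rankSelected⟩
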